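/- **Setting.** A stream is a finite sequence of items $\langle e,v\rangle$ (key $e$, value $v>0$), fixed before the hash functions are drawn; $N$ is the sum of all its values. An *error-sensible bucket* stores a candidate key $ID$ (initially null) and two counters $YES, NO$ (initially $0$). The sketch has layers $i=1,\dots,L$; layer $i$ has $w_i$ buckets, a lock threshold $\lambda_i$ and a hash function $h_i$ from keys to its buckets. The hash values $h_i(e)$, over all layers $i$ and keys $e$, are independent, and each is uniform on the $w_i$ buckets. Layer $L+1$ is a SpaceSaving summary with $m$ counters. To insert $\langle e,v\rangle$, go through $i=1,2,\dots,L$ and let $B$ be the bucket $h_i(e)$ of layer $i$. If $B.ID=e$, add $v$ to $B.YES$ and stop. Otherwise, if $B.NO+v>\lambda_i$ and $B.YES>\lambda_i$, replace $v$ by $v-(\lambda_i-B.NO)$, set $B.NO$ to $\lambda_i$ and continue with the next layer. Otherwise, add $v$ to $B.NO$, and if now $B.NO\ge B.YES$, set $B.ID$ to $e$ and swap $B.NO$ and $B.YES$; then stop. A value that is left over after layer $L$ is inserted into the SpaceSaving summary. **Parameters.** Let $R_w>1$, $R_\lambda>1$, $R_wR_\lambda\ge 2$, $\Lambda>0$,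 $0<\Delta<\frac14$, $N\ge e\Lambda$ (with $e$ here Euler's number, so that $\ln\ln\frac N\Lambda\ge 0$), and $$W=\frac{4N(R_wR_\lambda)^6}{\Lambda(R_w-1)(R_\lambda-1)},\quad w_i=\left\lceil\frac{W(R_w-1)}{R_w^i}\right\rceil,\quad \lambda_i=\frac{\Lambda(R_\lambda-1)}{R_\lambda^i},$$ $$\Delta_1=2R_w^2R_\lambda^2(R_\lambda-1),\quad \Delta_2=6R_w^3R_\lambda^4,\quad m=\left\lceil\Delta_2\ln\tfrac1\Delta\right\rceil.$$ Let the real number $d$ be the root of $$\frac{R_\lambda^{d}}{(R_wR_\lambda)^{2^{d}+d}}=\Delta_1\frac{\Lambda}{N}\ln\frac1\Delta ,$$ and let $L$ be $d$ rounded down or up to an integer (either choice is allowed; $L=0$ if this is negative). **Cost.** Space is counted in memory words, three for each bucket and three for each SpaceSaving counter. The time of an insertion is the number of layers that it accesses, where an access to one bucket, and likewise an update of the SpaceSaving summary (as layer $L+1$), counts as one step. **Theorem.** There is a constant $C>0$, depending only on $R_w$ and $R_\lambda$, such that for all $N,\Lambda,\Delta,d,L$ as above: 1. The sketch uses space at most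 $C\left(\frac N\Lambda+\ln\frac1\Delta\right)$. 2. For every stream with total value $N$, the expected time (over the hash functions) of each insertion is at most $C\left(1+\Delta\ln\ln\frac N\Lambda\right)$, and the expected total time of the insertion of all $M$ items of the stream is at most $C\left(1+\Delta\ln\ln\frac N\Lambda\right)M$; that is, the amortized insertion time is $O\left(1+\Delta\ln\ln\frac N\Lambda\right)$. -/

import Mathlib

open MeasureTheory ProbabilityTheory

namespace ReliableSketch

noncomputable section

/-! ## The error-sensible bucket with the lock mechanism -/

/-- An error-sensible bucket: candidate key (`none` is the null key), positive votes and
negative votes. -/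
structure Bucket (K : Type*) where
  key : Option K
  yes : ℝ
  no : ℝ

/-- The initial bucket. -/
def Bucket.empty (K : Type*) : Bucket K := ⟨none, 0, 0⟩

/-- Insertion of `⟨e, v⟩` into a bucket with lock threshold `lam`. The result is the new bucket
together with the value that is handed on to the next layer: `none` if the insertion ends in this
bucket, `some v'` if the lock is triggered and the value `v'` is left over. -/
def Bucket.insert {K : Type*} [DecidableEq K] (lam : ℝ) (e : K) (v : ℝ) (B : Bucket K) :
    Bucket K × Option ℝ :=
  if B.key = some e then
    (⟨B.key, B.yes + v, B.no⟩, none)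
  else if lam < B.no + v ∧ lam < B.yes then
    (⟨B.key, B.yes, lam⟩, some (v - (lam - B.no)))
  else if B.yes ≤ B.no + v then
    (⟨some e, B.no + v, B.yes⟩, none)
  else
    (⟨B.key, B.yes, B.no + v⟩, none)

/-! ## The SpaceSaving summary used as the last layer -/

/-- A SpaceSaving counter: monitored key, count, and overestimation error of the count. -/
structure Counter (K : Type*) where
  key : Option K
  count : ℝ
  err : ℝ

/-- The initial counter. -/
def Counter.empty (K : Type*) : Counter K := ⟨none, 0, 0⟩

open Classical in
/-- The SpaceSaving update: a monitored key has its counter increased; otherwise an unused counter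
is taken; otherwise a counter with the smallest count is taken over. -/
def spaceSavingInsert {K : Type*} {m : ℕ} (e : K) (v : ℝ) (T : Fin m → Counter K) :
    Fin m → Counter K :=
  if h : ∃ c, (T c).key = some e then
    Function.update T h.choose ⟨some e, (T h.choose).count + v, (T h.choose).err⟩
  else if h : ∃ c, (T c).key = none then
    Function.update T h.choose ⟨some e, v, 0⟩
  else if h : ∃ c, ∀ c', (T c).count ≤ (T c').count then
    Function.update T h.choose ⟨some e, (T h.choose).count + v, (T h.choose).count⟩
  else T

/-! ## The sketch -/

/-- The memory of a sketch with `L` layers of error-sensible buckets, `w i` buckets in layer `i`,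
followed by a SpaceSaving summary of `m` counters. -/
structure Sketch (K : Type*) {L : ℕ} (w : Fin L → ℕ) (m : ℕ) where
  bucket : (i : Fin L) → Fin (w i) → Bucket K
  tail : Fin m → Counter K

/-- The initial memory. -/
def Sketch.empty (K : Type*) {L : ℕ} (w : Fin L → ℕ) (m : ℕ) : Sketch K w m :=
  ⟨fun _ _ => Bucket.empty K, fun _ => Counter.empty K⟩

/-- The space, in memory words, of a sketch: three words for each bucket (`key`, `yes`, `no`)
and three words for each SpaceSaving counter (`key`, `count`, `err`). -/
def space {L : ℕ} (w : Fin L → ℕ) (m : ℕ) : ℕ := (∑ i, 3 * w i) + 3 * m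

/-- Overwrite the bucket number `j` of layer `i`. -/
def Sketch.setBucket {K : Type*} {L : ℕ} {w : Fin L → ℕ} {m : ℕ} (s : Sketch K w m)
    (i : Fin L) (j : Fin (w i)) (B : Bucket K) : Sketch K w m :=
  ⟨Function.update s.bucket i (Function.update (s.bucket i) j B), s.tail⟩

/-- Insertion of `⟨e, v⟩`, going through the given list of layers. The second component of the
result counts the steps: one for each layer that is accessed (hashing the key and processing one
bucket), and one for an update of the SpaceSaving summary. -/
def insertFrom {K : Type*} [DecidableEq K] {L : ℕ} {w : Fin L → ℕ} {m : ℕ} (lam : Fin L → ℝ)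
    (h : (i : Fin L) → K → Fin (w i)) (e : K) :
    List (Fin L) → ℝ → Sketch K w m → Sketch K w m × ℕ
  | [], v, s => (⟨s.bucket, spaceSavingInsert e v s.tail⟩, 1)
  | i :: is, v, s =>
    let r := (s.bucket i (h i e)).insert (lam i) e v
    let s' := s.setBucket i (h i e) r.1
    match r.2 with
    | none => (s', 1)
    | some v' =>
      let q := insertFrom lam h e is v' s'
      (q.1, q.2 + 1)

/-- Insertion of an item into the sketch with hash functions `h`: all layers are gone through in
order. The second component counts the steps. -/
def insert {K : Type*} [DecidableEq K] {L : ℕ} {w : Fin L → ℕ} {m : ℕ} (lam : Fin L → ℝ)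
    (h : (i : Fin L) → K → Fin (w i)) (x : K × ℝ) (s : Sketch K w m) : Sketch K w m × ℕ :=
  insertFrom lam h x.1 (List.finRange L) x.2 s

/-- The memory after a stream of items has been inserted into the initial sketch. -/
def run {K : Type*} [DecidableEq K] {L : ℕ} {w : Fin L → ℕ} (m : ℕ) (lam : Fin L → ℝ)
    (h : (i : Fin L) → K → Fin (w i)) (S : List (K × ℝ)) : Sketch K w m :=
  S.foldl (fun s x => (insert lam h x s).1) (Sketch.empty K w m)

/-- The number of steps taken by the insertion of the item number `t` of the stream `S`, after the
items that precede it have been inserted. -/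
def insertTime {K : Type*} [DecidableEq K] {L : ℕ} {w : Fin L → ℕ} (m : ℕ) (lam : Fin L → ℝ)
    (h : (i : Fin L) → K → Fin (w i)) (S : List (K × ℝ)) (t : Fin S.length) : ℕ :=
  (insert lam h (S.get t) (run m lam h (S.take t))).2

/-- The number of steps taken by the insertions of all items of the stream `S`. -/
def totalTime {K : Type*} [DecidableEq K] {L : ℕ} {w : Fin L → ℕ} (m : ℕ) (lam : Fin L → ℝ)
    (h : (i : Fin L) → K → Fin (w i)) (S : List (K × ℝ)) : ℕ :=
  ∑ t, insertTime m lam h S t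

/-! ## The random hash functions -/

/-- `H` consists of independent, fully random hash functions: all the hash values `H i e` are
independent, and `H i e` is uniform on the `w i` buckets of layer `i`. -/
structure IsUniformHash {Ω K : Type*} [MeasurableSpace Ω] (P : Measure Ω) {L : ℕ}
    {w : Fin L → ℕ} (H : (i : Fin L) → K → Ω → Fin (w i)) : Prop where
  measurable : ∀ i e, Measurable (H i e)
  indep : iIndepFun (fun p : Fin L × K => H p.1 p.2) P
  uniform : ∀ i e j, P {ω | H i e ω = j} = ((w i : ℕ) : ENNReal)⁻¹

/-! ## The parameters -/

/-- `W = 4 N (R_w R_λ)^6 / (Λ (R_w - 1) (R_λ - 1))`. -/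
def totalWidth (Rw Rl N Lam : ℝ) : ℝ := 4 * N * (Rw * Rl) ^ 6 / (Lam * (Rw - 1) * (Rl - 1))

/-- `w_{i+1} = ⌈W (R_w - 1) / R_w^{i+1}⌉`: the layers `1, …, L` are indexed by `0, …, L - 1`. -/
def width (Rw Rl N Lam : ℝ) (L : ℕ) (i : Fin L) : ℕ :=
  ⌈totalWidth Rw Rl N Lam * (Rw - 1) / Rw ^ (i.val + 1)⌉₊

/-- `λ_{i+1} = Λ (R_λ - 1) / R_λ^{i+1}`. -/
def threshold (Rl Lam : ℝ) (L : ℕ) (i : Fin L) : ℝ := Lam * (Rl - 1) / Rl ^ (i.val + 1)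

/-- `Δ₁ = 2 R_w^2 R_λ^2 (R_λ - 1)`. -/
def delta₁ (Rw Rl : ℝ) : ℝ := 2 * Rw ^ 2 * Rl ^ 2 * (Rl - 1)

/-- `Δ₂ = 6 R_w^3 R_λ^4`. -/
def delta₂ (Rw Rl : ℝ) : ℝ := 6 * Rw ^ 3 * Rl ^ 4

/-- The real number `d` is the root of
`R_λ^d / (R_w R_λ)^(2^d + d) = Δ₁ (Λ / N) ln (1 / Δ)`. -/
def IsDepthRoot (Rw Rl N Lam Del d : ℝ) : Prop :=
  Rl ^ d / (Rw * Rl) ^ ((2 : ℝ) ^ d + d) = delta₁ Rw Rl * (Lam / N) * Real.log (1 / Del)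

/-- The number of counters of the SpaceSaving summary, `⌈Δ₂ ln (1 / Δ)⌉`. -/
def tailSize (Rw Rl Del : ℝ) : ℕ := ⌈delta₂ Rw Rl * Real.log (1 / Del)⌉₊

end

end ReliableSketch

open MeasureTheory ProbabilityTheory

namespace ReliableSketch

open scoped BigOperators

/-! Space: the unrounded widths form a geometric series of sum at most `W`, rounding up costs one
bucket per layer, and the depth is `O(1 + ln ln (N/Λ))`, hence `O(N/Λ)`.

Time: an insertion takes one step more than the number of locks it triggers. The bucket of `e` in
layer `i` locks `e` out only if the other keys of that bucket have brought more than `λ_i`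
(`Sketch.Tracks.lt_otherLoad`); this stays true when loads are totals over the whole stream. The
totals arriving at layer `i` depend on the earlier hash functions only (`arrivals_congr`), so the
hash values of layer `i` are fresh.

Cap the totals at `λ_i`, divide by `λ_i`, and suppose that their sum is at most `V_i = x_i w_i`
(`w_i` unrounded). By Markov, a given key is overloaded with probability at most `x_i`
(`Resampling.expect_collision_le`). The value of all overloaded keys is less than `16 x_i V_i`,
except with probability `2 exp (-4 x_i V_i)` (`Resampling.expect_overflow_tail`). Hence `x_{i+1}`
may be taken of order `x_i ^ 2`: loads fall doubly exponentially.

The equation for `d` makes `4 x_i V_i` at least `ln (1/Δ)` up to two layers before `⌊d⌋`, and larger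
further up (`IsDepthRoot.exp_neg_le`), so the failure probabilities sum to at most `4Δ`. The
expected number of overloaded layers is thus at most `∑ x_i ≤ 1`, plus `4Δ` per layer, plus `1` for
a layer gained by rounding `d` up. Taking logarithms twice in the equation gives `d = O(1 + ln ln
(N/Λ))`. -/

noncomputable section Deterministic

/-! ### The route of one item through the layers -/

variable {K : Type*} [DecidableEq K] {L : ℕ} {w : Fin L → ℕ} {m : ℕ}

/-- The value with which an item, inserted into the sketch `s`, arrives at layer `n`
(`none` if it does not get there). -/
def arrival (lam : Fin L → ℝ) (h : (i : Fin L) → K → Fin (w i)) (x : K × ℝ)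
    (s : Sketch K w m) : ℕ → Option ℝ
  | 0 => some x.2
  | n + 1 =>
    if hn : n < L then
      (arrival lam h x s n).bind fun u =>
        ((s.bucket ⟨n, hn⟩ (h ⟨n, hn⟩ x.1)).insert (lam ⟨n, hn⟩) x.1 u).2
    else none

/-- The buckets of layer `k` after the insertion of an item. -/
def nextLayer (lam : Fin L → ℝ) (h : (i : Fin L) → K → Fin (w i)) (x : K × ℝ)
    (s : Sketch K w m) (k : Fin L) : Fin (w k) → Bucket K :=
  match arrival lam h x s k with
  | none => s.bucket k
  | some u => Function.update (s.bucket k) (h k x.1)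
      ((s.bucket k (h k x.1)).insert (lam k) x.1 u).1

theorem arrival_eq_none_of_le (lam : Fin L → ℝ) (h : (i : Fin L) → K → Fin (w i)) (x : K × ℝ)
    (s : Sketch K w m) {n k : ℕ} (hnk : n ≤ k) (hn : arrival lam h x s n = none) :
    arrival lam h x s k = none := by
  induction k, hnk using Nat.le_induction with
  | base => exact hn
  | succ k _ ih => simp [arrival, ih]

/-- A layer is visited at most once, so its bucket is still that of `s₀` when the item arrives, and
the route is a function of `s₀` alone. Every step but the first is paid for by one arrival further
down; arrival at level `L` pays for SpaceSaving. The induction is on the number `j` of layers left.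
-/
theorem insertFrom_drop_spec (lam : Fin L → ℝ) (h : (i : Fin L) → K → Fin (w i)) (x : K × ℝ)
    (s₀ : Sketch K w m) (j : ℕ) : ∀ (n : ℕ) (s : Sketch K w m) (u : ℝ), n + j = L →
    (∀ k : Fin L, n ≤ k.val → s.bucket k = s₀.bucket k) → arrival lam h x s₀ n = some u →
    (∀ k : Fin L, k.val < n →
      (insertFrom lam h x.1 ((List.finRange L).drop n) u s).1.bucket k = s.bucket k) ∧
    (∀ k : Fin L, n ≤ k.val →
      (insertFrom lam h x.1 ((List.finRange L).drop n) u s).1.bucket k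
        = nextLayer lam h x s₀ k) ∧
    (insertFrom lam h x.1 ((List.finRange L).drop n) u s).2
      ≤ 1 + ∑ k : Fin L, if n ≤ k.val ∧ (arrival lam h x s₀ (k + 1)).isSome then 1 else 0 := by
  induction j with
  | zero =>
    intro n s u hn hs hu
    have hnL : n = L := by omega
    have hd : (List.finRange L).drop n = [] := by simp [hnL]
    rw [hd]
    refine ⟨fun k _ => rfl, fun k hk => absurd k.2 (by omega), ?_⟩
    simp [insertFrom]
  | succ j ih =>
    intro n s u hn hs hu
    have hnL : n < L := by omega
    have hd : (List.finRange L).drop n = ⟨n, hnL⟩ :: (List.finRange L).drop (n + 1) := by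
      rw [List.drop_eq_getElem_cons (by simpa using hnL)]
      simp
    have hb : s.bucket ⟨n, hnL⟩ = s₀.bucket ⟨n, hnL⟩ := hs ⟨n, hnL⟩ le_rfl
    have hnext : nextLayer lam h x s₀ ⟨n, hnL⟩ = Function.update (s₀.bucket ⟨n, hnL⟩)
        (h ⟨n, hnL⟩ x.1)
        ((s₀.bucket ⟨n, hnL⟩ (h ⟨n, hnL⟩ x.1)).insert (lam ⟨n, hnL⟩) x.1 u).1 := by
      simp [nextLayer, hu]
    have harr : arrival lam h x s₀ (n + 1)
        = ((s₀.bucket ⟨n, hnL⟩ (h ⟨n, hnL⟩ x.1)).insert (lam ⟨n, hnL⟩) x.1 u).2 := by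
      simp [arrival, hnL, hu]
    set s' := s.setBucket ⟨n, hnL⟩ (h ⟨n, hnL⟩ x.1)
        ((s₀.bucket ⟨n, hnL⟩ (h ⟨n, hnL⟩ x.1)).insert (lam ⟨n, hnL⟩) x.1 u).1 with hs'
    have hs'n : s'.bucket ⟨n, hnL⟩ = nextLayer lam h x s₀ ⟨n, hnL⟩ := by
      rw [hnext, hs']
      simp [Sketch.setBucket, hb]
    have hs'ne : ∀ k : Fin L, k.val ≠ n → s'.bucket k = s.bucket k := by
      intro k hk
      rw [hs']
      simp only [Sketch.setBucket]
      rw [Function.update_of_ne]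
      intro hkn
      exact hk (by rw [hkn])
    rw [hd]
    simp only [insertFrom, hb, ← hs']
    cases hout : ((s₀.bucket ⟨n, hnL⟩ (h ⟨n, hnL⟩ x.1)).insert (lam ⟨n, hnL⟩) x.1 u).2 with
    | none =>
      rw [hout] at harr
      refine ⟨fun k hk => hs'ne k (by omega), fun k hk => ?_, ?_⟩
      · rcases eq_or_ne k.val n with hkn | hkn
        · obtain rfl : k = ⟨n, hnL⟩ := Fin.ext hkn
          exact hs'n
        · have : arrival lam h x s₀ k = none :=
            arrival_eq_none_of_le lam h x s₀ (by omega) harr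
          simp only [hs'ne k hkn, nextLayer, this]
          exact hs k hk
      · simp
    | some u' =>
      rw [hout] at harr
      obtain ⟨h1, h2, h3⟩ := ih (n + 1) s' u' (by omega)
        (fun k hk => by rw [hs'ne k (by omega)]; exact hs k (by omega)) harr
      refine ⟨fun k hk => ?_, fun k hk => ?_, ?_⟩
      · rw [h1 k (by omega), hs'ne k (by omega)]
      · rcases eq_or_ne k.val n with hkn | hkn
        · obtain rfl : k = ⟨n, hnL⟩ := Fin.ext hkn
          rw [h1 _ (Nat.lt_succ_self n)]
          exact hs'n
        · exact h2 k (by omega)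
      · have hsum : (∑ k : Fin L,
            if n + 1 ≤ k.val ∧ (arrival lam h x s₀ (k + 1)).isSome then 1 else 0) + 1
            ≤ ∑ k : Fin L, if n ≤ k.val ∧ (arrival lam h x s₀ (k + 1)).isSome then 1 else 0 := by
          rw [← Finset.add_sum_erase _ _ (Finset.mem_univ (⟨n, hnL⟩ : Fin L)),
            ← Finset.add_sum_erase _ _ (Finset.mem_univ (⟨n, hnL⟩ : Fin L))]
          have : ∑ k ∈ Finset.univ.erase (⟨n, hnL⟩ : Fin L),
              (if n + 1 ≤ k.val ∧ (arrival lam h x s₀ (k + 1)).isSome then 1 else 0)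
              ≤ ∑ k ∈ Finset.univ.erase (⟨n, hnL⟩ : Fin L),
              if n ≤ k.val ∧ (arrival lam h x s₀ (k + 1)).isSome then 1 else 0 := by
            apply Finset.sum_le_sum
            intro k _
            split_ifs <;> first | omega | skip
            rename_i ha hb
            exact absurd ⟨by omega, ha.2⟩ hb
          simp only [harr, Option.isSome_some, le_refl, and_self, if_true, Nat.not_succ_le_self,
            false_and, if_false, zero_add]
          omega
        show _ + 1 ≤ _
        omega

theorem insert_bucket (lam : Fin L → ℝ) (h : (i : Fin L) → K → Fin (w i)) (x : K × ℝ)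
    (s : Sketch K w m) (k : Fin L) :
    (insert lam h x s).1.bucket k = nextLayer lam h x s k :=
  (insertFrom_drop_spec lam h x s L 0 s x.2 (by simp) (fun _ _ => rfl) rfl).2.1 k (Nat.zero_le _)

theorem insert_time_le (lam : Fin L → ℝ) (h : (i : Fin L) → K → Fin (w i)) (x : K × ℝ)
    (s : Sketch K w m) :
    (insert lam h x s).2
      ≤ 1 + ∑ k : Fin L, if (arrival lam h x s (k + 1)).isSome then 1 else 0 := by
  have := (insertFrom_drop_spec lam h x s L 0 s x.2 (by simp) (fun _ _ => rfl) rfl).2.2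
  simpa [insert] using this

/-! ### Bookkeeping of absorbed values -/

/-- `B` is a possible state of a bucket with threshold `lam` that has absorbed the value `a e` of
each key `e ∈ Ks`. -/
structure Bucket.Tracks (Ks : Finset K) (lam : ℝ) (a : K → ℝ) (B : Bucket K) : Prop where
  no_le : B.no ≤ lam
  no_le_yes : B.no ≤ B.yes
  le_no : ∀ e, B.key ≠ some e → a e ≤ B.no
  le_yes : ∀ e, B.key = some e → a e ≤ B.yes
  le_sum : B.yes + B.no ≤ ∑ e ∈ Ks, a e

/-- `δ` is the part of `v` that the bucket keeps. In a swap, the old `YES`, which bounds the old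
candidate, becomes the new `NO`, and `NO + v`, which bounds `e`, becomes the new `YES`. -/
theorem Bucket.Tracks.insert {Ks : Finset K} {lam : ℝ} {a : K → ℝ} {B : Bucket K}
    (hB : B.Tracks Ks lam a) {e : K} (he : e ∈ Ks) {v : ℝ} (hv : 0 < v) :
    (∃ δ, 0 ≤ δ ∧ δ ≤ v ∧
      (B.insert lam e v).1.Tracks Ks lam (fun e' => a e' + if e = e' then δ else 0)) ∧
    ∀ v', (B.insert lam e v).2 = some v' →
      0 < v' ∧ v' ≤ v ∧ B.key ≠ some e ∧ lam < B.yes := by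
  obtain ⟨h1, h2, h3, h4, h5⟩ := hB
  have hsum : ∀ δ : ℝ, ∑ e' ∈ Ks, (a e' + if e = e' then δ else 0) = ∑ e' ∈ Ks, a e' + δ := by
    intro δ
    simp [Finset.sum_add_distrib, he]
  unfold Bucket.insert
  split_ifs with c1 c2 c3
  · refine ⟨⟨v, hv.le, le_rfl, ⟨h1, by simp; linarith, ?_, ?_, ?_⟩⟩, by simp⟩
    · intro e' he'
      have : e ≠ e' := fun hh => he' (hh ▸ c1)
      simpa [this] using h3 e' he'
    · intro e' he'
      have : e = e' := by simpa [c1] using he'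
      have := h4 e c1
      subst_vars
      simpa using this
    · rw [hsum]
      simp only
      linarith
  · refine ⟨⟨lam - B.no, by linarith, by linarith, ⟨le_rfl, c2.2.le, ?_, ?_, ?_⟩⟩, ?_⟩
    · intro e' he'
      have := h3 e' he'
      simp only
      split_ifs <;> linarith
    · intro e' he'
      have hne : e ≠ e' := fun hh => c1 (hh ▸ he')
      simpa [hne] using h4 e' he'
    · rw [hsum]
      simp only
      linarith
    · intro v' hv'
      simp only [Option.some.injEq] at hv'
      refine ⟨by linarith [c2.1], by linarith, c1, c2.2⟩
  -- With `YES > lam` the swap condition would give `NO + v > lam`, and the lock would have been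
  -- triggered.
  · have hle : B.yes ≤ lam := by
      by_contra hc
      exact c2 ⟨by linarith, by linarith⟩
    refine ⟨⟨v, hv.le, le_rfl, ⟨hle, c3, ?_, ?_, ?_⟩⟩, by simp⟩
    · intro e' he'
      have hne : e ≠ e' := fun hh => he' (by simp [hh])
      simp only [hne, if_false, add_zero]
      by_cases hk : B.key = some e'
      · exact h4 e' hk
      · exact (h3 e' hk).trans h2
    · intro e' he'
      have heq : e = e' := by simpa using he'
      subst heq
      have := h3 e c1
      simp only [if_true]
      linarith
    · rw [hsum]
      simp only
      linarith
  · have hle : B.no + v ≤ lam := by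
      by_contra hc
      exact c2 ⟨by linarith, by linarith⟩
    refine ⟨⟨v, hv.le, le_rfl, ⟨hle, by simp only; linarith, ?_, ?_, ?_⟩⟩, by simp⟩
    · intro e' he'
      have := h3 e' he'
      simp only
      split_ifs <;> linarith
    · intro e' he'
      have hne : e ≠ e' := fun hh => c1 (hh ▸ he')
      simpa [hne] using h4 e' he'
    · rw [hsum]
      simp only
      linarith

/-- The buckets of `s` are possible states if `f n e` is the total value of key `e` that has
arrived at layer `n`. -/
def Sketch.Tracks (Ks : Finset K) (lam : Fin L → ℝ) (h : (i : Fin L) → K → Fin (w i))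
    (f : ℕ → K → ℝ) (s : Sketch K w m) : Prop :=
  ∀ i j, ∃ a : K → ℝ, (s.bucket i j).Tracks Ks (lam i) a ∧
    ∀ e, a e ≤ if h i e = j then f i e else 0

/-! ### Overload by other keys as a condition for leaving a layer -/

/-- The total value of the other keys that share the bucket of `e`. -/
def otherLoad {κ J : Type*} [DecidableEq κ] [DecidableEq J] (Ks : Finset κ) (g : κ → J)
    (f : κ → ℝ) (e : κ) : ℝ :=
  ∑ e' ∈ Ks with e' ≠ e ∧ g e' = g e, f e'

theorem otherLoad_mono {κ J : Type*} [DecidableEq κ] [DecidableEq J] {Ks : Finset κ} {g : κ → J}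
    {f f' : κ → ℝ} (hf : ∀ e, f e ≤ f' e) (e : κ) :
    otherLoad Ks g f e ≤ otherLoad Ks g f' e :=
  Finset.sum_le_sum fun e' _ => hf e'

/-- As `e` is not the candidate, `NO` already covers what the bucket absorbed of `e`. Cancelling it
in `YES + NO ≤` total leaves `YES` bounded by the other keys. -/
theorem Sketch.Tracks.lt_otherLoad {Ks : Finset K} {lam : Fin L → ℝ}
    {h : (i : Fin L) → K → Fin (w i)} {f : ℕ → K → ℝ} {s : Sketch K w m}
    (hs : s.Tracks Ks lam h f) {e : K} (he : e ∈ Ks) (i : Fin L)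
    (hkey : (s.bucket i (h i e)).key ≠ some e) (hyes : lam i < (s.bucket i (h i e)).yes) :
    lam i < otherLoad Ks (h i) (f i) e := by
  obtain ⟨a, ha, hle⟩ := hs i (h i e)
  have h1 := ha.le_sum
  have h2 := ha.le_no e hkey
  rw [← Finset.add_sum_erase _ _ he] at h1
  have h3 : ∑ e' ∈ Ks.erase e, a e' ≤ ∑ e' ∈ Ks.erase e, if h i e' = h i e then f i e' else 0 :=
    Finset.sum_le_sum fun e' _ => hle e'
  rw [← Finset.sum_filter] at h3
  have h4 : (Ks.erase e).filter (fun e' => h i e' = h i e)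
      = Ks.filter (fun e' => e' ≠ e ∧ h i e' = h i e) := by
    ext e'
    simp only [Finset.mem_filter, Finset.mem_erase]
    tauto
  rw [h4] at h3
  unfold otherLoad
  linarith

theorem Sketch.Tracks.arrival_succ {Ks : Finset K} {lam : Fin L → ℝ}
    {h : (i : Fin L) → K → Fin (w i)} {f : ℕ → K → ℝ} {s : Sketch K w m}
    (hs : s.Tracks Ks lam h f) {x : K × ℝ} (hx : x.1 ∈ Ks) {n : ℕ}
    (hpos : ∀ u, arrival lam h x s n = some u → 0 < u) {u' : ℝ}
    (hu' : arrival lam h x s (n + 1) = some u') :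
    ∃ hn : n < L, ∃ u, arrival lam h x s n = some u ∧ 0 < u' ∧ u' ≤ u ∧
      lam ⟨n, hn⟩ < otherLoad Ks (h ⟨n, hn⟩) (f n) x.1 := by
  by_cases hn : n < L
  · simp only [arrival, hn, dif_pos, Option.bind_eq_some_iff] at hu'
    obtain ⟨u, hu, hout⟩ := hu'
    obtain ⟨a, ha, -⟩ := hs ⟨n, hn⟩ (h ⟨n, hn⟩ x.1)
    obtain ⟨h1, h2, h3, h4⟩ := (ha.insert hx (hpos u hu)).2 u' hout
    exact ⟨hn, u, hu, h1, h2, hs.lt_otherLoad hx ⟨n, hn⟩ h3 h4⟩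
  · simp [arrival, hn] at hu'

theorem Sketch.Tracks.arrival_pos {Ks : Finset K} {lam : Fin L → ℝ}
    {h : (i : Fin L) → K → Fin (w i)} {f : ℕ → K → ℝ} {s : Sketch K w m}
    (hs : s.Tracks Ks lam h f) {x : K × ℝ} (hx : x.1 ∈ Ks) (hv : 0 < x.2) (n : ℕ) :
    ∀ u, arrival lam h x s n = some u → 0 < u := by
  induction n with
  | zero =>
    intro u hu
    simp only [arrival, Option.some.injEq] at hu
    exact hu ▸ hv
  | succ n ih =>
    intro u hu
    obtain ⟨_, _, _, h1, _⟩ := hs.arrival_succ hx ih hu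
    exact h1

/-- The contribution of an item to the total value of key `e` that arrives at layer `n`. -/
def contribution (lam : Fin L → ℝ) (h : (i : Fin L) → K → Fin (w i)) (x : K × ℝ)
    (s : Sketch K w m) (n : ℕ) (e : K) : ℝ :=
  if x.1 = e then (arrival lam h x s n).getD 0 else 0

theorem Sketch.Tracks.contribution_nonneg {Ks : Finset K} {lam : Fin L → ℝ}
    {h : (i : Fin L) → K → Fin (w i)} {f : ℕ → K → ℝ} {s : Sketch K w m}
    (hs : s.Tracks Ks lam h f) {x : K × ℝ} (hx : x.1 ∈ Ks) (hv : 0 < x.2) (n : ℕ) (e : K) :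
    0 ≤ contribution lam h x s n e := by
  unfold contribution
  split_ifs
  · cases hu : arrival lam h x s n with
    | none => simp
    | some u => simpa using (hs.arrival_pos hx hv n u hu).le
  · exact le_rfl

theorem Sketch.Tracks.insert {Ks : Finset K} {lam : Fin L → ℝ}
    {h : (i : Fin L) → K → Fin (w i)} {f : ℕ → K → ℝ} {s : Sketch K w m}
    (hs : s.Tracks Ks lam h f) {x : K × ℝ} (hx : x.1 ∈ Ks) (hv : 0 < x.2) :
    (ReliableSketch.insert lam h x s).1.Tracks Ks lam h
      (fun n e => f n e + contribution lam h x s n e) := by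
  intro i j
  rw [insert_bucket]
  have hc := hs.contribution_nonneg hx hv i
  obtain ⟨a, ha, hle⟩ := hs i j
  have hweak : ∀ e, a e ≤ if h i e = j then f i e + contribution lam h x s i e else 0 := by
    intro e
    refine (hle e).trans ?_
    split_ifs
    · linarith [hc e]
    · exact le_rfl
  cases hu : arrival lam h x s i with
  | none =>
    simp only [nextLayer, hu]
    exact ⟨a, ha, hweak⟩
  | some u =>
    simp only [nextLayer, hu]
    by_cases hj : h i x.1 = j
    · subst hj
      rw [Function.update_self]
      obtain ⟨δ, h0, h1, h2⟩ := (ha.insert hx (hs.arrival_pos hx hv i u hu)).1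
      refine ⟨_, h2, fun e => ?_⟩
      by_cases he : x.1 = e
      · subst he
        have := hle x.1
        simp only [if_true] at this
        simp only [if_true, contribution, hu, Option.getD_some]
        linarith
      · simpa [he] using hweak e
    · rw [Function.update_of_ne (Ne.symm hj)]
      exact ⟨a, ha, hweak⟩

theorem Sketch.tracks_empty {κ : Type*} (Ks : Finset κ) {lam : Fin L → ℝ}
    (hlam : ∀ i, 0 ≤ lam i) (h : (i : Fin L) → κ → Fin (w i)) :
    (Sketch.empty κ w m).Tracks Ks lam h (fun _ _ => 0) := by
  intro i j
  refine ⟨fun _ => 0, ⟨?_, ?_, ?_, ?_, ?_⟩, fun e => by simp⟩ <;>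
    simp [Sketch.empty, Bucket.empty, hlam i]

/-! ### Totals over a stream -/

/-- The total value of key `e` that arrives at layer `n` while a stream is inserted into `s`. -/
def arrivals (lam : Fin L → ℝ) (h : (i : Fin L) → K → Fin (w i)) :
    List (K × ℝ) → Sketch K w m → ℕ → K → ℝ
  | [], _ => fun _ _ => 0
  | x :: xs, s => fun n e =>
    contribution lam h x s n e + arrivals lam h xs (insert lam h x s).1 n e

theorem arrivals_append (lam : Fin L → ℝ) (h : (i : Fin L) → K → Fin (w i))
    (xs ys : List (K × ℝ)) (s : Sketch K w m) (n : ℕ) (e : K) :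
    arrivals lam h (xs ++ ys) s n e = arrivals lam h xs s n e
      + arrivals lam h ys (xs.foldl (fun s x => (insert lam h x s).1) s) n e := by
  induction xs generalizing s with
  | nil => simp [arrivals]
  | cons x xs ih => simp [arrivals, ih, add_assoc]

theorem Sketch.Tracks.foldl {Ks : Finset K} {lam : Fin L → ℝ}
    {h : (i : Fin L) → K → Fin (w i)} {f : ℕ → K → ℝ} {s : Sketch K w m}
    (hs : s.Tracks Ks lam h f) {xs : List (K × ℝ)} (hxs : ∀ x ∈ xs, x.1 ∈ Ks ∧ 0 < x.2) :
    (xs.foldl (fun s x => (ReliableSketch.insert lam h x s).1) s).Tracks Ks lam h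
      (fun n e => f n e + arrivals lam h xs s n e) := by
  induction xs generalizing s f with
  | nil => simpa [arrivals] using hs
  | cons x xs ih =>
    have hx := hxs x (by simp)
    have := ih (hs.insert hx.1 hx.2) (fun y hy => hxs y (by simp [hy]))
    simpa [arrivals, add_assoc] using this

theorem Sketch.Tracks.arrivals_nonneg {Ks : Finset K} {lam : Fin L → ℝ}
    {h : (i : Fin L) → K → Fin (w i)} {f : ℕ → K → ℝ} {s : Sketch K w m}
    (hs : s.Tracks Ks lam h f) {xs : List (K × ℝ)} (hxs : ∀ x ∈ xs, x.1 ∈ Ks ∧ 0 < x.2)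
    (n : ℕ) (e : K) : 0 ≤ arrivals lam h xs s n e := by
  induction xs generalizing s f with
  | nil => simp [arrivals]
  | cons x xs ih =>
    have hx := hxs x (by simp)
    exact add_nonneg (hs.contribution_nonneg hx.1 hx.2 n e)
      (ih (hs.insert hx.1 hx.2) (fun y hy => hxs y (by simp [hy])))

theorem sum_arrivals_zero {Ks : Finset K} (lam : Fin L → ℝ)
    (h : (i : Fin L) → K → Fin (w i)) (s : Sketch K w m)
    {xs : List (K × ℝ)} (hxs : ∀ x ∈ xs, x.1 ∈ Ks) :
    ∑ e ∈ Ks, arrivals lam h xs s 0 e = (xs.map Prod.snd).sum := by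
  induction xs generalizing s with
  | nil => simp [arrivals]
  | cons x xs ih =>
    have hx := hxs x (by simp)
    simp only [arrivals, Finset.sum_add_distrib, List.map_cons, List.sum_cons,
      ih _ (fun y hy => hxs y (by simp [hy]))]
    simp [contribution, arrival, hx]

/-- Here `f` holds the arrivals before `xs`. Loads only grow with time, so a lock at any moment
witnesses an overload by the final totals. -/
theorem Sketch.Tracks.arrivals_succ {Ks : Finset K} {lam : Fin L → ℝ}
    {h : (i : Fin L) → K → Fin (w i)} {f : ℕ → K → ℝ} {s : Sketch K w m}
    (hs : s.Tracks Ks lam h f) {xs : List (K × ℝ)} (hxs : ∀ x ∈ xs, x.1 ∈ Ks ∧ 0 < x.2)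
    (i : Fin L) (e : K) :
    arrivals lam h xs s (i + 1) e ≤ arrivals lam h xs s i e ∧
    (arrivals lam h xs s (i + 1) e ≠ 0 →
      lam i < otherLoad Ks (h i) (fun e' => f i e' + arrivals lam h xs s i e') e) := by
  induction xs generalizing s f with
  | nil => simp [arrivals]
  | cons x xs ih =>
    have hx := hxs x (by simp)
    have hxs' : ∀ y ∈ xs, y.1 ∈ Ks ∧ 0 < y.2 := fun y hy => hxs y (by simp [hy])
    have hs' := hs.insert hx.1 hx.2
    obtain ⟨ih1, ih2⟩ := ih hs' hxs'
    have key : contribution lam h x s (i + 1) e ≤ contribution lam h x s i e ∧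
        (contribution lam h x s (i + 1) e ≠ 0 → lam i < otherLoad Ks (h i) (f i) e) := by
      unfold contribution
      split_ifs with he
      · subst he
        cases hu : arrival lam h x s (i + 1) with
        | none =>
          have := hs.contribution_nonneg hx.1 hx.2 i x.1
          simpa [contribution] using this
        | some u' =>
          obtain ⟨_, u, h1, h2, h3, h4⟩ :=
            hs.arrival_succ hx.1 (hs.arrival_pos hx.1 hx.2 i) hu
          rw [h1]
          exact ⟨by simpa using h3, fun _ => h4⟩
      · simp
    refine ⟨add_le_add key.1 ih1, fun hne => ?_⟩
    by_cases hc : contribution lam h x s (i + 1) e = 0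
    · have := ih2 (by simpa [arrivals, hc] using hne)
      simpa [arrivals, add_assoc] using this
    · refine (key.2 hc).trans_le (otherLoad_mono (fun e' => ?_) e)
      have h1 := hs.contribution_nonneg hx.1 hx.2 i e'
      have h2 := hs'.arrivals_nonneg hxs' i e'
      simp only [arrivals]
      linarith

/-- Replacing the loads of the prefix by those of the whole stream removes the dependence on the
time `t`. -/
theorem insertTime_le {Ks : Finset K} {lam : Fin L → ℝ} (hlam : ∀ i, 0 ≤ lam i)
    (h : (i : Fin L) → K → Fin (w i)) {S : List (K × ℝ)}
    (hS : ∀ x ∈ S, x.1 ∈ Ks ∧ 0 < x.2) (t : Fin S.length) :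
    (insertTime m lam h S t : ℝ) ≤ 1 + ∑ i : Fin L,
      if lam i < otherLoad Ks (h i) (arrivals lam h S (Sketch.empty K w m) i) (S.get t).1
        then 1 else 0 := by
  have h0 := Sketch.tracks_empty (m := m) Ks hlam h
  have hx := hS (S.get t) (List.get_mem S t)
  have htake : ∀ x ∈ S.take t, x.1 ∈ Ks ∧ 0 < x.2 := fun x hx => hS x (List.mem_of_mem_take hx)
  have hdrop : ∀ x ∈ S.drop t, x.1 ∈ Ks ∧ 0 < x.2 := fun x hx => hS x (List.mem_of_mem_drop hx)
  have hrun := h0.foldl htake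
  simp only [zero_add] at hrun
  have htime : (insertTime m lam h S t : ℝ) ≤ 1 + ∑ k : Fin L,
      if (arrival lam h (S.get t) (run m lam h (S.take t)) (k + 1)).isSome then (1 : ℝ) else 0 := by
    have := insert_time_le lam h (S.get t) (run m lam h (S.take t))
    have h' : ((insertTime m lam h S t : ℕ) : ℝ) ≤ ((1 + ∑ k : Fin L,
      if (arrival lam h (S.get t) (run m lam h (S.take t)) (k + 1)).isSome then 1 else 0 : ℕ) : ℝ) :=
      Nat.cast_le.mpr this
    push_cast at h'
    exact h'
  refine htime.trans (add_le_add le_rfl (Finset.sum_le_sum fun i _ => ?_))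
  split_ifs with h1 h2 <;> first | exact le_rfl | norm_num
  obtain ⟨u', hu'⟩ := Option.isSome_iff_exists.mp h1
  obtain ⟨_, _, _, _, _, h4⟩ :=
    hrun.arrival_succ hx.1 (hrun.arrival_pos hx.1 hx.2 i) hu'
  refine absurd (h4.trans_le (otherLoad_mono (fun e' => ?_) _)) h2
  have := arrivals_append lam h (S.take t) (S.drop t) (Sketch.empty K w m) i e'
  rw [List.take_append_drop] at this
  rw [this]
  have := hrun.arrivals_nonneg hdrop i e'
  linarith

/-! ### Dependence on the hash functions -/

theorem arrival_congr {lam : Fin L → ℝ} {h h' : (i : Fin L) → K → Fin (w i)} {x : K × ℝ} {n : ℕ}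
    (hh : ∀ i : Fin L, i.val < n → h i x.1 = h' i x.1) {s s' : Sketch K w m}
    (hs : ∀ i : Fin L, i.val < n → s.bucket i = s'.bucket i) {k : ℕ} (hk : k ≤ n) :
    arrival lam h x s k = arrival lam h' x s' k := by
  induction k with
  | zero => rfl
  | succ k ih =>
    simp only [arrival]
    split_ifs with hkL
    · rw [ih (by omega), hh ⟨k, hkL⟩ hk, hs ⟨k, hkL⟩ hk]
    · rfl

theorem insert_bucket_congr {lam : Fin L → ℝ} {h h' : (i : Fin L) → K → Fin (w i)} {x : K × ℝ}
    {n : ℕ} (hh : ∀ i : Fin L, i.val < n → h i x.1 = h' i x.1) {s s' : Sketch K w m}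
    (hs : ∀ i : Fin L, i.val < n → s.bucket i = s'.bucket i) (i : Fin L) (hi : i.val < n) :
    (insert lam h x s).1.bucket i = (insert lam h' x s').1.bucket i := by
  simp only [insert_bucket, nextLayer, arrival_congr hh hs hi.le, hs i hi, hh i hi]

/-- The source of independence between layers: hash values of layer `n` can be resampled without
changing what arrives there. -/
theorem arrivals_congr {lam : Fin L → ℝ} {h h' : (i : Fin L) → K → Fin (w i)} {n : ℕ}
    {xs : List (K × ℝ)} (hh : ∀ i : Fin L, i.val < n → ∀ x ∈ xs, h i x.1 = h' i x.1)
    {s s' : Sketch K w m} (hs : ∀ i : Fin L, i.val < n → s.bucket i = s'.bucket i) (e : K) :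
    arrivals lam h xs s n e = arrivals lam h' xs s' n e := by
  induction xs generalizing s s' with
  | nil => rfl
  | cons x xs ih =>
    have hx : ∀ i : Fin L, i.val < n → h i x.1 = h' i x.1 := fun i hi => hh i hi x (by simp)
    simp only [arrivals, contribution, arrival_congr hx hs le_rfl]
    rw [ih (fun i hi y hy => hh i hi y (by simp [hy])) (insert_bucket_congr hx hs)]

end Deterministic

/-! ### One layer of random hash values -/

/-- `upd a k j` replaces the hash value `g a k` by `j`, and replacing it by a uniformly random value
does not change expectations over `a`. -/
structure Resampling {A κ J : Type*} [Fintype A] [Fintype J] [DecidableEq κ]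
    (g : A → κ → J) (upd : A → κ → J → A) : Prop where
  apply : ∀ a k j, g (upd a k j) = Function.update (g a) k j
  expect_eq : ∀ k (F : A → ℝ), 𝔼 a, F a = 𝔼 a, 𝔼 j, F (upd a k j)

/-- The map `(a, j) ↦ (update a p j, a p)` is an involution. -/
theorem expect_update {ι : Type*} [Fintype ι] [DecidableEq ι] {β : ι → Type*}
    [∀ i, Fintype (β i)] (p : ι) [Nonempty (β p)] (F : (∀ i, β i) → ℝ) :
    𝔼 a, F a = 𝔼 a, 𝔼 j, F (Function.update a p j) := by
  have h1 : 𝔼 x : (∀ i, β i) × β p, F (Function.update x.1 p x.2)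
      = 𝔼 x : (∀ i, β i) × β p, F x.1 := by
    refine Finset.expect_nbij' (fun x => (Function.update x.1 p x.2, x.1 p))
      (fun x => (Function.update x.1 p x.2, x.1 p)) ?_ ?_ ?_ ?_ ?_ <;> simp
  rw [← Finset.univ_product_univ, Finset.expect_product, Finset.expect_product] at h1
  rw [h1]
  simp

/-- The hash function of layer `i`, from the family of all hash values. -/
abbrev layerHash {L : ℕ} {κ : Type*} {w : Fin L → ℕ} (a : (p : Fin L × κ) → Fin (w p.1))
    (i : Fin L) (k : κ) : Fin (w i) :=
  a (i, k)

theorem resampling_update {L : ℕ} {κ : Type*} [Fintype κ] [DecidableEq κ] {w : Fin L → ℕ}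
    (i : Fin L) (hw : 0 < w i) :
    Resampling (fun (a : (p : Fin L × κ) → Fin (w p.1)) => layerHash a i)
      (fun a k (j : Fin (w i)) => Function.update a (i, k) j) where
  apply a k j := by
    ext k'
    by_cases hk : k' = k
    · subst hk; simp
    · simp [hk]
  expect_eq k F := by
    have : Nonempty (Fin (w (i, k).1)) := ⟨⟨0, hw⟩⟩
    exact expect_update (i, k) F

section OneLayer

variable {A κ J : Type*} [Fintype A] [Fintype J] [Fintype κ] [DecidableEq κ] [DecidableEq J]
  {g : A → κ → J} {upd : A → κ → J → A}

/-- Markov's inequality for the load next to `e`. The predicate `good` and the values `c` stand for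
data of earlier layers, untouched by `upd`. -/
theorem Resampling.expect_collision_le (hR : Resampling g upd) [Nonempty A] [Nonempty J]
    (good : A → Prop) [DecidablePred good] (c : A → κ → ℝ)
    (hgood : ∀ a k j, good (upd a k j) ↔ good a) (hc : ∀ a k j, c (upd a k j) = c a)
    (hc0 : ∀ a k, 0 ≤ c a k) {x : ℝ} (hx : 0 ≤ x)
    (hsum : ∀ a, good a → ∑ k, c a k ≤ x * Fintype.card J) (e : κ) :
    𝔼 a, (if good a ∧ 1 ≤ otherLoad Finset.univ (g a) (c a) e then (1 : ℝ) else 0) ≤ x := by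
  have hJ : (0 : ℝ) < Fintype.card J := by exact_mod_cast Fintype.card_pos
  calc
    𝔼 a, (if good a ∧ 1 ≤ otherLoad Finset.univ (g a) (c a) e then (1 : ℝ) else 0)
      ≤ 𝔼 a, ∑ k ∈ Finset.univ.erase e,
          (if good a then c a k else 0) * (if g a k = g a e then 1 else 0) := by
        refine Finset.expect_le_expect fun a _ => ?_
        by_cases ha : good a
        · have : ∑ k ∈ Finset.univ.erase e,
              (if good a then c a k else 0) * (if g a k = g a e then 1 else 0)
              = otherLoad Finset.univ (g a) (c a) e := by
            have hf : Finset.univ.filter (fun k => k ≠ e ∧ g a k = g a e)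
                = (Finset.univ.erase e).filter (fun k => g a k = g a e) := by
              ext k; simp
            rw [otherLoad, hf, Finset.sum_filter]
            simp [ha]
          rw [this]
          split_ifs with h1
          · exact h1.2
          · exact Finset.sum_nonneg fun k _ => hc0 a k
        · simp [ha]
    _ = ∑ k ∈ Finset.univ.erase e, 𝔼 a, (if good a then c a k else 0) * (Fintype.card J : ℝ)⁻¹ := by
        rw [Finset.expect_sum_comm]
        refine Finset.sum_congr rfl fun k hk => ?_
        -- Resampling `k ≠ e` leaves the bucket of `e` in place, so `k` hits it with probability `1
        -- / card J`.
        rw [hR.expect_eq k]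
        refine Finset.expect_congr rfl fun a _ => ?_
        have hne : e ≠ k := (Finset.ne_of_mem_erase hk).symm
        simp only [hgood, hc, hR.apply, Function.update_self, Function.update_of_ne hne]
        rw [← Finset.mul_expect, Finset.expect_eq_sum_div_card]
        simp
    _ = 𝔼 a, ∑ k ∈ Finset.univ.erase e, (if good a then c a k else 0) * (Fintype.card J : ℝ)⁻¹ := by
        rw [Finset.expect_sum_comm]
    _ ≤ x := by
        refine Finset.expect_le Finset.univ_nonempty fun a _ => ?_
        by_cases ha : good a
        · simp only [ha, if_true]
          rw [← Finset.sum_mul, ← div_eq_mul_inv, div_le_iff₀ hJ]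
          refine le_trans ?_ (hsum a ha)
          exact Finset.sum_le_sum_of_subset_of_nonneg (Finset.erase_subset _ _)
            fun k _ _ => hc0 a k
        · simpa [ha] using hx

/-! ### Exponential moments of the overflowing value -/

/-- The total value of the keys of smaller rank that share the bucket of `k`. -/
def lowerLoad {κ J : Type*} [Fintype κ] [DecidableEq J] (r : κ → ℕ) (g : κ → J) (c : κ → ℝ)
    (k : κ) : ℝ :=
  ∑ l with r l < r k ∧ g l = g k, c l

/-- The total value of the keys whose bucket is loaded with at least `1 / 2` by keys of smaller
rank. -/
noncomputable def lowerOverflow {κ J : Type*} [Fintype κ] [DecidableEq J] (r : κ → ℕ) (g : κ → J)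
    (c : κ → ℝ) : ℝ :=
  ∑ k, if 1 / 2 ≤ lowerLoad r g c k then c k else 0

/-- Uses `exp u ≤ 1 + 2u` on `[0, 1]`, and that the indicator of `load ≥ 1/2` is at most `2 * load`.
-/
theorem expect_exp_ite_le {J : Type*} [Fintype J] [Nonempty J] {load : J → ℝ} (hload : ∀ j, 0 ≤ load j) {x u : ℝ}
    (hu0 : 0 ≤ u) (hu1 : u ≤ 1) (hsum : ∑ j, load j ≤ x * Fintype.card J) :
    𝔼 j, Real.exp (if 1 / 2 ≤ load j then u else 0) ≤ Real.exp (4 * x * u) := by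
  have hJ : (0 : ℝ) < Fintype.card J := by exact_mod_cast Fintype.card_pos
  have hexp : Real.exp u ≤ 1 + 2 * u := by
    have := Real.abs_exp_sub_one_le (x := u) (by rw [abs_of_nonneg hu0]; exact hu1)
    rw [abs_of_nonneg hu0] at this
    linarith [le_abs_self (Real.exp u - 1)]
  calc
    𝔼 j, Real.exp (if 1 / 2 ≤ load j then u else 0) ≤ 𝔼 j, (1 + 4 * u * load j) := by
        refine Finset.expect_le_expect fun j _ => ?_
        split_ifs with h1
        · nlinarith
        · rw [Real.exp_zero]
          nlinarith [mul_nonneg hu0 (hload j)]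
    _ = 1 + 4 * u * ((∑ j, load j) / Fintype.card J) := by
        rw [Finset.expect_add_distrib, ← Finset.mul_expect, Fintype.expect_eq_sum_div_card load]
        simp
    _ ≤ 1 + 4 * u * x := by
        have := (div_le_iff₀ hJ).mpr hsum
        gcongr
    _ ≤ Real.exp (4 * x * u) := by
        have := Real.add_one_le_exp (4 * x * u)
        linarith

/-- A hybrid argument in order of rank: in `Φ s`, keys of rank below `s` count with their true
contribution, the others with the budget `4 x c`. Passing from `s` to `s + 1` resamples a single key
and does not raise the average. -/
theorem Resampling.expect_exp_lowerOverflow_le (hR : Resampling g upd) [Nonempty A] [Nonempty J]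
    (good : A → Prop) [DecidablePred good] (c : A → κ → ℝ)
    (hgood : ∀ a k j, good (upd a k j) ↔ good a) (hc : ∀ a k j, c (upd a k j) = c a)
    (hc0 : ∀ a k, 0 ≤ c a k) (hc1 : ∀ a k, c a k ≤ 1) {x V : ℝ} (hx : 0 ≤ x)
    (hV : V ≤ x * Fintype.card J)
    (hsum : ∀ a, good a → ∑ k, c a k ≤ V) (r : κ → ℕ) (hr : Function.Injective r) :
    𝔼 a, (if good a then Real.exp (lowerOverflow r (g a) (c a)) else 0)
      ≤ 𝔼 a, if good a then Real.exp (4 * x * V) else 0 := by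
  let term (s : ℕ) (a : A) (k : κ) : ℝ :=
    if r k < s then (if 1 / 2 ≤ lowerLoad r (g a) (c a) k then c a k else 0) else 4 * x * c a k
  let Φ (s : ℕ) (a : A) : ℝ := if good a then Real.exp (∑ k, term s a k) else 0
  have hstep : ∀ s, 𝔼 a, Φ (s + 1) a ≤ 𝔼 a, Φ s a := by
    intro s
    by_cases hs : ∃ k, r k = s
    · obtain ⟨k₀, hk₀⟩ := hs
      rw [hR.expect_eq k₀]
      refine Finset.expect_le_expect fun a _ => ?_
      by_cases ha : good a
      -- Keys of rank below `s` are loaded only by still smaller ranks, so the hash value of `k₀`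
      -- does not affect them. This is why only lower ranks count.
      · have hrest : ∀ j, ∀ k ∈ Finset.univ.erase k₀, term (s + 1) (upd a k₀ j) k = term s a k := by
          intro j k hk
          have hne : k ≠ k₀ := Finset.ne_of_mem_erase hk
          have hrk : r k ≠ s := fun hh => hne (hr (hh.trans hk₀.symm))
          have hlt : r k < s + 1 ↔ r k < s := by omega
          simp only [term, hlt, hc]
          by_cases h1 : r k < s
          · have hload : lowerLoad r (g (upd a k₀ j)) (c a) k = lowerLoad r (g a) (c a) k := by
              unfold lowerLoad
              refine Finset.sum_congr (Finset.filter_congr fun l _ => ?_) fun _ _ => rfl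
              refine and_congr_right fun hl => ?_
              have hlne : l ≠ k₀ := by
                rintro rfl
                omega
              rw [hR.apply, Function.update_of_ne hlne, Function.update_of_ne hne]
            rw [if_pos h1, if_pos h1, hload]
          · rw [if_neg h1, if_neg h1]
        let load (j : J) : ℝ := ∑ l with r l < s ∧ g a l = j, c a l
        have hk₀term : ∀ j, term (s + 1) (upd a k₀ j) k₀
            = if 1 / 2 ≤ load j then c a k₀ else 0 := by
          intro j
          have hload : lowerLoad r (g (upd a k₀ j)) (c a) k₀ = load j := by
            unfold lowerLoad
            refine Finset.sum_congr (Finset.filter_congr fun l _ => ?_) fun _ _ => rfl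
            rw [hk₀]
            refine and_congr_right fun hl => ?_
            have hlne : l ≠ k₀ := by
              rintro rfl
              omega
            rw [hR.apply, Function.update_of_ne hlne, Function.update_self]
          simp only [term, hk₀, Nat.lt_succ_self, if_true, hc, hload]
        have hΦ1 : ∀ j, Φ (s + 1) (upd a k₀ j)
            = Real.exp (∑ k ∈ Finset.univ.erase k₀, term s a k)
              * Real.exp (if 1 / 2 ≤ load j then c a k₀ else 0) := by
          intro j
          simp only [Φ, hgood, ha, if_true]
          rw [← Finset.sum_erase_add _ _ (Finset.mem_univ k₀), Real.exp_add, hk₀term,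
            Finset.sum_congr rfl (hrest j)]
        have hΦ0 : Φ s a = Real.exp (∑ k ∈ Finset.univ.erase k₀, term s a k)
            * Real.exp (4 * x * c a k₀) := by
          simp only [Φ, ha, if_true]
          rw [← Finset.sum_erase_add _ _ (Finset.mem_univ k₀), Real.exp_add]
          simp [term, hk₀]
        simp only [hΦ1, hΦ0]
        rw [← Finset.mul_expect]
        refine mul_le_mul_of_nonneg_left ?_ (Real.exp_pos _).le
        refine expect_exp_ite_le (fun j => Finset.sum_nonneg fun l _ => hc0 a l) (hc0 a k₀)
          (hc1 a k₀) ?_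
        refine le_trans ?_ ((hsum a ha).trans hV)
        have hj : ∑ j, load j = ∑ l with r l < s, c a l := by
          simp only [load, Finset.sum_filter, ite_and]
          rw [Finset.sum_comm]
          refine Finset.sum_congr rfl fun l _ => ?_
          split_ifs <;> simp
        rw [hj]
        exact Finset.sum_le_sum_of_subset_of_nonneg (Finset.filter_subset _ _)
          fun l _ _ => hc0 a l
      · simp [Φ, hgood, ha]
    · have hlt : ∀ k, r k < s + 1 ↔ r k < s := fun k => by
        have : r k ≠ s := fun hh => hs ⟨k, hh⟩
        omega
      simp only [Φ, term, hlt]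
      exact le_rfl
  have hall : ∀ s, 𝔼 a, Φ s a ≤ 𝔼 a, Φ 0 a := by
    intro s
    induction s with
    | zero => exact le_rfl
    | succ s ih => exact (hstep s).trans ih
  obtain ⟨s, hs⟩ : ∃ s, ∀ k, r k < s :=
    ⟨Finset.univ.sup r + 1, fun k => Nat.lt_succ_of_le (Finset.le_sup (Finset.mem_univ k))⟩
  have hΦs : ∀ a, Φ s a = if good a then Real.exp (lowerOverflow r (g a) (c a)) else 0 := by
    intro a
    simp only [Φ, term, hs, if_true, lowerOverflow]
  simp only [← hΦs]
  refine (hall s).trans (Finset.expect_le_expect fun a _ => ?_)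
  by_cases ha : good a
  · simp only [Φ, term, ha, if_true, Nat.not_lt_zero, if_false]
    rw [← Finset.mul_sum]
    have := hsum a ha
    gcongr
  · simp [Φ, ha]

theorem Resampling.expect_lowerOverflow_tail (hR : Resampling g upd) [Nonempty A] [Nonempty J]
    (good : A → Prop) [DecidablePred good] (c : A → κ → ℝ)
    (hgood : ∀ a k j, good (upd a k j) ↔ good a) (hc : ∀ a k j, c (upd a k j) = c a)
    (hc0 : ∀ a k, 0 ≤ c a k) (hc1 : ∀ a k, c a k ≤ 1) {x V : ℝ} (hx : 0 ≤ x)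
    (hV : V ≤ x * Fintype.card J)
    (hsum : ∀ a, good a → ∑ k, c a k ≤ V) (r : κ → ℕ) (hr : Function.Injective r) :
    𝔼 a, (if good a ∧ 8 * x * V ≤ lowerOverflow r (g a) (c a) then (1 : ℝ) else 0)
      ≤ Real.exp (-(4 * x * V)) := by
  have h1 := hR.expect_exp_lowerOverflow_le good c hgood hc hc0 hc1 hx hV hsum r hr
  calc
    𝔼 a, (if good a ∧ 8 * x * V ≤ lowerOverflow r (g a) (c a) then (1 : ℝ) else 0)
      ≤ 𝔼 a, Real.exp (-(8 * x * V)) *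
          (if good a then Real.exp (lowerOverflow r (g a) (c a)) else 0) := by
        refine Finset.expect_le_expect fun a _ => ?_
        by_cases ha : good a
        · simp only [ha, true_and, if_true]
          rw [← Real.exp_add]
          split_ifs with h2
          · exact Real.one_le_exp (by linarith)
          · exact (Real.exp_pos _).le
        · simp [ha]
    _ ≤ Real.exp (-(8 * x * V)) * 𝔼 a, (if good a then Real.exp (4 * x * V) else 0) := by
        rw [← Finset.mul_expect]
        exact mul_le_mul_of_nonneg_left h1 (Real.exp_pos _).le
    _ ≤ Real.exp (-(8 * x * V)) * Real.exp (4 * x * V) := by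
        refine mul_le_mul_of_nonneg_left ?_ (Real.exp_pos _).le
        refine Finset.expect_le Finset.univ_nonempty fun a _ => ?_
        split_ifs
        · exact le_rfl
        · exact (Real.exp_pos _).le
    _ = Real.exp (-(4 * x * V)) := by
        rw [← Real.exp_add]
        congr 1
        ring

/-- The total value of the keys whose bucket is loaded with at least `1` by other keys. -/
noncomputable def overflow {κ J : Type*} [Fintype κ] [DecidableEq κ] [DecidableEq J] (g : κ → J)
    (c : κ → ℝ) : ℝ :=
  ∑ k, if 1 ≤ otherLoad Finset.univ g c k then c k else 0

/-- Each other key precedes `k` in at least one of the two orders, so a load of `1` leaves at least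
`1/2` in one of them. -/
theorem overflow_le_add {κ J : Type*} [Fintype κ] [DecidableEq κ] [DecidableEq J] {r r' : κ → ℕ} (hr : ∀ k l, k ≠ l → r k < r l ∨ r' k < r' l)
    (g : κ → J) {c : κ → ℝ} (hc : ∀ k, 0 ≤ c k) :
    overflow g c ≤ lowerOverflow r g c + lowerOverflow r' g c := by
  unfold overflow lowerOverflow
  rw [← Finset.sum_add_distrib]
  refine Finset.sum_le_sum fun k _ => ?_
  have hsplit : otherLoad Finset.univ g c k ≤ lowerLoad r g c k + lowerLoad r' g c k := by
    unfold otherLoad lowerLoad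
    simp only [Finset.sum_filter]
    rw [← Finset.sum_add_distrib]
    refine Finset.sum_le_sum fun l _ => ?_
    have h1 := hc l
    by_cases hl : l ≠ k ∧ g l = g k
    · rcases hr l k hl.1 with h2 | h2 <;> simp only [hl, h2, and_self, if_true, ne_eq,
        not_false_eq_true] <;> split_ifs <;> linarith
    · rw [if_neg hl]
      split_ifs <;> linarith
  have h1 := hc k
  split_ifs <;> linarith

theorem Resampling.expect_overflow_tail (hR : Resampling g upd) [Nonempty A] [Nonempty J]
    (good : A → Prop) [DecidablePred good] (c : A → κ → ℝ)
    (hgood : ∀ a k j, good (upd a k j) ↔ good a) (hc : ∀ a k j, c (upd a k j) = c a)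
    (hc0 : ∀ a k, 0 ≤ c a k) (hc1 : ∀ a k, c a k ≤ 1) {x V : ℝ} (hx : 0 ≤ x)
    (hV : V ≤ x * Fintype.card J) (hsum : ∀ a, good a → ∑ k, c a k ≤ V) :
    𝔼 a, (if good a ∧ 16 * x * V ≤ overflow (g a) (c a) then (1 : ℝ) else 0)
      ≤ 2 * Real.exp (-(4 * x * V)) := by
  let r (k : κ) : ℕ := Fintype.equivFin κ k
  -- The reverse order; the subtraction never truncates, since `r k < card κ`.
  let r' (k : κ) : ℕ := Fintype.card κ - r k
  have hrlt : ∀ k, r k < Fintype.card κ := fun k => (Fintype.equivFin κ k).2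
  have hr : Function.Injective r := fun k l hkl =>
    (Fintype.equivFin κ).injective (Fin.ext hkl)
  have hr' : Function.Injective r' := fun k l hkl => hr (by
    have h1 := hrlt k
    have h2 := hrlt l
    simp only [r'] at hkl
    omega)
  have hrr : ∀ k l, k ≠ l → r k < r l ∨ r' k < r' l := fun k l hkl => by
    have h1 := hrlt k
    have h2 := hrlt l
    have h3 : r k ≠ r l := fun hh => hkl (hr hh)
    simp only [r']
    omega
  have h1 := hR.expect_lowerOverflow_tail good c hgood hc hc0 hc1 hx hV hsum r hr
  have h2 := hR.expect_lowerOverflow_tail good c hgood hc hc0 hc1 hx hV hsum r' hr'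
  rw [two_mul]
  refine le_trans ?_ (add_le_add h1 h2)
  rw [← Finset.expect_add_distrib]
  refine Finset.expect_le_expect fun a _ => ?_
  have := overflow_le_add hrr (g a) (hc0 a)
  by_cases ha : good a
  · simp only [ha, true_and]
    split_ifs <;> linarith
  · simp [ha]

end OneLayer

/-! ### All layers -/

/-- Capping loses no overload: either one key reaches the cap and contributes `1` alone, or no key
is changed. -/
theorem one_le_otherLoad_min {κ J : Type*} [DecidableEq κ] [DecidableEq J] {Ks : Finset κ}
    {g : κ → J} {f : κ → ℝ} (hf : ∀ k, 0 ≤ f k) {lam : ℝ} (hlam : 0 < lam) {e : κ}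
    (h : lam < otherLoad Ks g f e) : 1 ≤ otherLoad Ks g (fun k => min (f k) lam / lam) e := by
  unfold otherLoad at *
  by_cases hbig : ∃ k ∈ Ks.filter (fun k => k ≠ e ∧ g k = g e), lam ≤ f k
  · obtain ⟨k, hk, hle⟩ := hbig
    have := Finset.single_le_sum (f := fun k => min (f k) lam / lam)
      (fun l _ => div_nonneg (le_min (hf l) hlam.le) hlam.le) hk
    simpa [min_eq_right hle, hlam.ne'] using this
  · push Not at hbig
    rw [← Finset.sum_div, le_div_iff₀ hlam, one_mul]
    rw [Finset.sum_congr rfl fun k hk => min_eq_left (hbig k hk).le]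
    exact h.le

/-- Arrivals at the layers of a sketch, as functions of the hash values `a (i, k)`: the arrivals at
layer `n` are determined by the previous layers, and a key gets from layer `i` to the next one
only if the other keys of its bucket have a total value above the threshold. -/
structure LayeredArrivals {L : ℕ} {κ : Type*} [Fintype κ] [DecidableEq κ] {w : Fin L → ℕ}
    (lam : ℕ → ℝ) (X : ((p : Fin L × κ) → Fin (w p.1)) → ℕ → κ → ℝ) : Prop where
  nonneg : ∀ a n k, 0 ≤ X a n k
  congr : ∀ a a' n, (∀ p : Fin L × κ, p.1.val < n → a p = a' p) → X a n = X a' n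
  le : ∀ a (i : Fin L) k, X a (i + 1) k ≤ X a i k
  lt_otherLoad : ∀ a (i : Fin L) k, X a (i + 1) k ≠ 0 →
    lam i < otherLoad Finset.univ (layerHash a i) (X a i) k

namespace LayeredArrivals

variable {L : ℕ} {κ : Type*} [Fintype κ] [DecidableEq κ] {w : Fin L → ℕ}
  {lam : ℕ → ℝ} {X : ((p : Fin L × κ) → Fin (w p.1)) → ℕ → κ → ℝ}

theorem update_eq (hX : LayeredArrivals lam X) (i : Fin L) (a : (p : Fin L × κ) → Fin (w p.1))
    (k : κ) (j : Fin (w i)) : X (Function.update a (i, k) j) i = X a i := by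
  refine hX.congr _ _ _ fun p hp => ?_
  rw [Function.update_of_ne]
  rintro rfl
  exact lt_irrefl _ hp

theorem expect_lt_otherLoad_le (hX : LayeredArrivals lam X) (hw : ∀ i, 0 < w i) (i : Fin L)
    (hlam : 0 < lam i) {x V : ℝ} (hx : 0 ≤ x) (hV : V ≤ x * w i) (e : κ) :
    𝔼 a, (if lam i < otherLoad Finset.univ (layerHash a i) (X a i) e then (1 : ℝ) else 0)
      ≤ 𝔼 a, (if lam i * V < ∑ k, min (X a i k) (lam i) then (1 : ℝ) else 0) + x := by
  have : ∀ p : Fin L × κ, Nonempty (Fin (w p.1)) := fun p => ⟨⟨0, hw p.1⟩⟩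
  have : Nonempty (Fin (w i)) := ⟨⟨0, hw i⟩⟩
  have h1 := (resampling_update (κ := κ) i (hw i)).expect_collision_le
    (fun a => ¬ lam i * V < ∑ k, min (X a i k) (lam i))
    (fun a k => min (X a i k) (lam i) / lam i)
    (fun a k j => by simp only [hX.update_eq]) (fun a k j => by simp only [hX.update_eq])
    (fun a k => div_nonneg (le_min (hX.nonneg a i k) hlam.le) hlam.le) hx
    (fun a ha => by
      rw [← Finset.sum_div, div_le_iff₀ hlam, Fintype.card_fin]
      nlinarith [not_lt.mp ha]) e
  refine le_trans ?_ (add_le_add le_rfl h1)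
  rw [← Finset.expect_add_distrib]
  refine Finset.expect_le_expect fun a _ => ?_
  by_cases hY : lam i < otherLoad Finset.univ (layerHash a i) (X a i) e
  · have := one_le_otherLoad_min (hX.nonneg a i) hlam hY
    simp only [hY, this, and_true, if_true]
    split_ifs <;> norm_num
  · rw [if_neg hY]
    split_ifs <;> norm_num

/-- Whatever reaches the next layer belongs to overloaded keys, and the lower cap only shrinks it,
so `overflow` dominates it. An excess is either inherited from layer `i` or a tail event of its hash
function. -/
theorem expect_excess_succ_le (hX : LayeredArrivals lam X) (hw : ∀ i, 0 < w i) (i : Fin L)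
    (hlam : 0 < lam i) (hlam' : 0 ≤ lam (i + 1)) (hanti : lam (i + 1) ≤ lam i)
    {x V V' : ℝ} (hx : 0 ≤ x) (hV : V ≤ x * w i)
    (hV' : lam i * (16 * x * V) ≤ lam (i + 1) * V') :
    𝔼 a, (if lam (i + 1) * V' < ∑ k, min (X a (i + 1) k) (lam (i + 1)) then (1 : ℝ) else 0)
      ≤ 𝔼 a, (if lam i * V < ∑ k, min (X a i k) (lam i) then (1 : ℝ) else 0)
        + 2 * Real.exp (-(4 * x * V)) := by
  have : ∀ p : Fin L × κ, Nonempty (Fin (w p.1)) := fun p => ⟨⟨0, hw p.1⟩⟩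
  have : Nonempty (Fin (w i)) := ⟨⟨0, hw i⟩⟩
  have h1 := (resampling_update (κ := κ) i (hw i)).expect_overflow_tail (V := V)
    (fun a => ¬ lam i * V < ∑ k, min (X a i k) (lam i))
    (fun a k => min (X a i k) (lam i) / lam i)
    (fun a k j => by simp only [hX.update_eq]) (fun a k j => by simp only [hX.update_eq])
    (fun a k => div_nonneg (le_min (hX.nonneg a i k) hlam.le) hlam.le)
    (fun a k => (div_le_one hlam).mpr (min_le_right _ _)) hx
    (by rwa [Fintype.card_fin])
    (fun a ha => by
      rw [← Finset.sum_div, div_le_iff₀ hlam]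
      nlinarith [not_lt.mp ha])
  refine le_trans ?_ (add_le_add le_rfl h1)
  rw [← Finset.expect_add_distrib]
  refine Finset.expect_le_expect fun a _ => ?_
  have hle : ∑ k, min (X a (i + 1) k) (lam (i + 1)) ≤ lam i *
      overflow (layerHash a i) (fun k => min (X a i k) (lam i) / lam i) := by
    unfold overflow
    rw [Finset.mul_sum]
    refine Finset.sum_le_sum fun k _ => ?_
    by_cases h0 : X a (i + 1) k = 0
    · rw [h0, min_eq_left hlam']
      split_ifs
      · exact mul_nonneg hlam.le (div_nonneg (le_min (hX.nonneg a i k) hlam.le) hlam.le)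
      · simp
    · rw [if_pos (one_le_otherLoad_min (hX.nonneg a i) hlam (hX.lt_otherLoad a i k h0)),
        mul_div_cancel₀ _ hlam.ne']
      exact min_le_min (hX.le a i k) hanti
  by_cases hgood : lam i * V < ∑ k, min (X a i k) (lam i)
  · simp only [hgood, not_true_eq_false, false_and, if_true, if_false]
    split_ifs <;> norm_num
  · by_cases hbad : lam (i + 1) * V' < ∑ k, min (X a (i + 1) k) (lam (i + 1))
    · have : 16 * x * V ≤ overflow (layerHash a i) (fun k => min (X a i k) (lam i) / lam i) :=
        le_of_mul_le_mul_left ((hV'.trans hbad.le).trans hle) hlam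
      simp [hgood, hbad, this]
    · rw [if_neg hbad]
      split_ifs <;> norm_num

end LayeredArrivals

/-! ### From random hash functions to uniformly distributed families of hash values -/

/-- On finitely many keys, independence and uniformity give every family of hash values the same
probability, so the integral is a finite average. `K` itself may be infinite. -/
theorem IsUniformHash.lintegral_restrict {Ω K : Type*} [DecidableEq K] [MeasurableSpace Ω] {P : Measure Ω} {L : ℕ}
    {w : Fin L → ℕ} {H : (i : Fin L) → K → Ω → Fin (w i)} (hH : IsUniformHash P H)
    (hw : ∀ i, 0 < w i) (Ks : Finset K) {F : ((p : Fin L × Ks) → Fin (w p.1)) → ℝ}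
    (hF : ∀ a, 0 ≤ F a) :
    ∫⁻ ω, ENNReal.ofReal (F fun p => H p.1 p.2 ω) ∂P = ENNReal.ofReal (𝔼 a, F a) := by
  let ρ : Ω → (p : Fin L × Ks) → Fin (w p.1) := fun ω p => H p.1 p.2 ω
  have hρ : Measurable ρ := measurable_pi_lambda _ fun p => hH.measurable p.1 p.2
  have hcard : (Fintype.card ((p : Fin L × Ks) → Fin (w p.1)) : ℝ) = ∏ p : Fin L × Ks, (w p.1 : ℝ) := by
    simp [Fintype.card_pi]
  have hpos : (0 : ℝ) < ∏ p : Fin L × Ks, (w p.1 : ℝ) :=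
    Finset.prod_pos fun p _ => by exact_mod_cast hw p.1
  have hinj : Function.Injective (fun p : Fin L × Ks => ((p.1, (p.2 : K)) : Fin L × K)) := by
    rintro ⟨i, e⟩ ⟨i', e'⟩ h
    simp only [Prod.mk.injEq] at h
    exact Prod.ext h.1 (Subtype.ext h.2)
  have hind := hH.indep.precomp hinj
  have hprob : ∀ a, P (ρ ⁻¹' {a}) = ENNReal.ofReal (∏ p : Fin L × Ks, (w p.1 : ℝ))⁻¹ := by
    intro a
    have hset : ρ ⁻¹' {a} = ⋂ p ∈ (Finset.univ : Finset (Fin L × Ks)),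
        (fun ω => H p.1 p.2 ω) ⁻¹' {a p} := by
      ext ω
      simp [ρ, funext_iff]
    rw [hset, hind.measure_inter_preimage_eq_mul Finset.univ
      (sets := fun p => {a p}) (fun p _ => MeasurableSet.singleton _)]
    have : ∀ p : Fin L × Ks, P ((fun ω => H p.1 p.2 ω) ⁻¹' {a p})
        = ENNReal.ofReal ((w p.1 : ℝ)⁻¹) := by
      intro p
      have h0 : (0 : ℝ) < w p.1 := by exact_mod_cast hw p.1
      rw [ENNReal.ofReal_inv_of_pos h0, ENNReal.ofReal_natCast]
      exact hH.uniform p.1 p.2 (a p)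
    rw [Finset.prod_congr rfl fun p _ => this p, ← ENNReal.ofReal_prod_of_nonneg
      (fun p _ => by positivity), Finset.prod_inv_distrib]
  have hmap : ∫⁻ ω, ENNReal.ofReal (F (ρ ω)) ∂P = ∫⁻ a, ENNReal.ofReal (F a) ∂(P.map ρ) :=
    (lintegral_map (f := fun a => ENNReal.ofReal (F a)) (measurable_of_finite _) hρ).symm
  refine hmap.trans ?_
  rw [lintegral_fintype]
  simp only [Measure.map_apply hρ (MeasurableSet.singleton _), hprob]
  rw [Fintype.expect_eq_sum_div_card, hcard, div_eq_mul_inv, Finset.sum_mul,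
    ENNReal.ofReal_sum_of_nonneg fun a _ => mul_nonneg (hF a) (inv_nonneg.mpr hpos.le)]
  exact Finset.sum_congr rfl fun a _ => (ENNReal.ofReal_mul (hF a)).symm

section Restriction

variable {K : Type*} [DecidableEq K] {L : ℕ} {w : Fin L → ℕ}

/-- Hash functions with the given hash values on `Ks`. -/
def extendHash {K : Type*} [DecidableEq K] {L : ℕ} {w : Fin L → ℕ} (hw : ∀ i, 0 < w i)
    {Ks : Finset K} (a : (p : Fin L × Ks) → Fin (w p.1)) (i : Fin L) (e : K) : Fin (w i) :=
  if he : e ∈ Ks then a (i, ⟨e, he⟩) else ⟨0, hw i⟩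

/-- The arrivals of a stream, as functions of the hash values of its keys. -/
noncomputable def keyArrivals (m : ℕ) (lam : ℕ → ℝ) (hw : ∀ i, 0 < w i) (Ks : Finset K)
    (S : List (K × ℝ)) (a : (p : Fin L × Ks) → Fin (w p.1)) (n : ℕ) (k : Ks) : ℝ :=
  arrivals (fun i : Fin L => lam i) (extendHash hw a) S (Sketch.empty K w m) n k

theorem otherLoad_extendHash (hw : ∀ i, 0 < w i) {Ks : Finset K}
    (a : (p : Fin L × Ks) → Fin (w p.1)) (i : Fin L) (f : K → ℝ) (k : Ks) :
    otherLoad Ks (extendHash hw a i) f k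
      = otherLoad Finset.univ (layerHash a i) (fun k' : Ks => f k') k := by
  unfold otherLoad
  rw [Finset.sum_filter, Finset.sum_filter, ← Finset.sum_coe_sort Ks]
  have hext : ∀ k' : Ks, extendHash hw a i k' = a (i, k') := fun k' => dif_pos k'.2
  refine Finset.sum_congr rfl fun k' _ => ?_
  simp only [hext, layerHash, ne_eq, Subtype.coe_inj]

theorem layeredArrivals_keyArrivals (m : ℕ) {lam : ℕ → ℝ} (hlam : ∀ n, 0 ≤ lam n)
    (hw : ∀ i, 0 < w i) {Ks : Finset K} {S : List (K × ℝ)} (hS : ∀ x ∈ S, x.1 ∈ Ks ∧ 0 < x.2) :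
    LayeredArrivals lam (keyArrivals m lam hw Ks S) := by
  have h0 := fun h => Sketch.tracks_empty (w := w) (m := m) Ks (fun i : Fin L => hlam i) h
  refine ⟨fun a n k => (h0 _).arrivals_nonneg hS n k, fun a a' n haa => ?_,
    fun a i k => ((h0 _).arrivals_succ hS i k).1, fun a i k hk => ?_⟩
  · funext k
    refine arrivals_congr (fun i hi x hx => ?_) (fun _ _ => rfl) _
    simp only [extendHash]
    split_ifs with he
    · exact haa _ hi
    · rfl
  · have := ((h0 (extendHash hw a)).arrivals_succ hS i k).2 hk
    simp only [zero_add] at this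
    rwa [otherLoad_extendHash] at this

theorem sum_keyArrivals_zero (m : ℕ) (lam : ℕ → ℝ) (hw : ∀ i, 0 < w i) {Ks : Finset K}
    {S : List (K × ℝ)} (hS : ∀ x ∈ S, x.1 ∈ Ks) (a : (p : Fin L × Ks) → Fin (w p.1)) :
    ∑ k, keyArrivals m lam hw Ks S a 0 k = (S.map Prod.snd).sum := by
  rw [← sum_arrivals_zero (fun i : Fin L => lam i) (extendHash hw a) (Sketch.empty K w m) hS]
  exact Finset.sum_coe_sort Ks _

/-- The number of layers at which the other keys of the bucket of `k` exceed the threshold. -/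
noncomputable def overloads {κ : Type*} [Fintype κ] [DecidableEq κ] (lam : ℕ → ℝ)
    (X : ((p : Fin L × κ) → Fin (w p.1)) → ℕ → κ → ℝ) (k : κ)
    (a : (p : Fin L × κ) → Fin (w p.1)) : ℝ :=
  ∑ i : Fin L, if lam i < otherLoad Finset.univ (layerHash a i) (X a i) k then 1 else 0

theorem insertTime_le_overloads (m : ℕ) {lam : ℕ → ℝ} (hlam : ∀ n, 0 ≤ lam n)
    (hw : ∀ i, 0 < w i) {Ks : Finset K} {S : List (K × ℝ)}
    (hS : ∀ x ∈ S, x.1 ∈ Ks ∧ 0 < x.2) (h : (i : Fin L) → K → Fin (w i)) (t : Fin S.length) :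
    (insertTime m (fun i : Fin L => lam i) h S t : ℝ) ≤ 1 + overloads lam
      (keyArrivals m lam hw Ks S) ⟨(S.get t).1, (hS _ (List.get_mem S t)).1⟩
      (fun p => h p.1 p.2) := by
  refine (insertTime_le (m := m) (fun i : Fin L => hlam i) h hS t).trans_eq ?_
  unfold overloads
  congr 1
  refine Finset.sum_congr rfl fun i _ => ?_
  have hext : ∀ i : Fin L, ∀ e ∈ Ks, h i e
      = extendHash hw (fun p : Fin L × Ks => h p.1 p.2) i e := fun i e he => by
    simp [extendHash, he]
  have harr : ∀ e, arrivals (fun i : Fin L => lam i) h S (Sketch.empty K w m) i e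
      = arrivals (fun i : Fin L => lam i) (extendHash hw (fun p : Fin L × Ks => h p.1 p.2)) S
        (Sketch.empty K w m) i e := fun e =>
    arrivals_congr (fun i _ x hx => hext i x.1 (hS x hx).1) (fun _ _ => rfl) e
  have hload : otherLoad Ks (h i) (arrivals (fun i : Fin L => lam i) h S (Sketch.empty K w m) i)
      (S.get t).1 = otherLoad Finset.univ (layerHash (fun p : Fin L × Ks => h p.1 p.2) i)
        (keyArrivals m lam hw Ks S (fun p => h p.1 p.2) i)
        ⟨(S.get t).1, (hS _ (List.get_mem S t)).1⟩ := by
    rw [funext harr]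
    unfold otherLoad
    rw [Finset.sum_filter, Finset.sum_filter, ← Finset.sum_coe_sort Ks]
    refine Finset.sum_congr rfl fun k' _ => ?_
    simp only [layerHash, keyArrivals, ne_eq, Subtype.ext_iff]
  rw [hload]

end Restriction

/-! ### Expected number of overloaded layers -/

/-- The failure bounds grow geometrically towards layer `M`, so their partial sums are at most twice
the last term; the `x n` sum to at most `1`. -/
theorem LayeredArrivals.expect_overloads_le {L : ℕ} {κ : Type*} [Fintype κ] [DecidableEq κ]
    {w : Fin L → ℕ} {lam : ℕ → ℝ} {X : ((p : Fin L × κ) → Fin (w p.1)) → ℕ → κ → ℝ}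
    (hX : LayeredArrivals lam X) (hw : ∀ i, 0 < w i) (hlam : ∀ n, 0 < lam n)
    (hanti : ∀ n, lam (n + 1) ≤ lam n) {x V : ℕ → ℝ} (hx0 : ∀ n, 0 ≤ x n)
    (hx1 : ∀ n, x n ≤ (1 / 2) ^ (n + 1)) (hV : ∀ i : Fin L, V i ≤ x i * w i)
    (hVsucc : ∀ n, lam n * (16 * x n * V n) ≤ lam (n + 1) * V (n + 1))
    (hzero : ∀ a, ∑ k, X a 0 k ≤ lam 0 * V 0) {Del : ℝ} (hDel0 : 0 < Del) (hDel1 : Del < 1 / 4)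
    {M : ℕ} (hLM : L ≤ M + 1)
    (htail : ∀ n, n + 2 ≤ M → Real.exp (-(4 * x n * V n)) ≤ Del * (1 / 2) ^ (M - 2 - n)) (k : κ) :
    𝔼 a, overloads lam X k a ≤ 3 + 4 * Del * M := by
  have hne : ∀ p : Fin L × κ, Nonempty (Fin (w p.1)) := fun p => ⟨⟨0, hw p.1⟩⟩
  have hexcess : ∀ n, n ≤ L → n + 1 ≤ M →
      𝔼 a, (if lam n * V n < ∑ k, min (X a n k) (lam n) then (1 : ℝ) else 0)
        ≤ 4 * Del * (1 / 2) ^ (M - 1 - n) := by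
    intro n
    induction n with
    | zero =>
      intro _ _
      have : ∀ a, ¬ lam 0 * V 0 < ∑ k, min (X a 0 k) (lam 0) := fun a => not_lt.mpr
        ((Finset.sum_le_sum fun k _ => min_le_left _ _).trans (hzero a))
      simp only [this, if_false, Finset.expect_const_zero]
      positivity
    | succ n ih =>
      intro hnL hnM
      have h1 := hX.expect_excess_succ_le hw ⟨n, hnL⟩ (hlam n) (hlam (n + 1)).le (hanti n)
        (hx0 n) (hV ⟨n, hnL⟩) (hVsucc n)
      have h2 := ih (by omega) (by omega)
      have h3 := htail n hnM
      have h4 : M - 1 - n = (M - 2 - n) + 1 := by omega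
      have h5 : M - 1 - (n + 1) = M - 2 - n := by omega
      rw [h4, pow_succ] at h2
      rw [h5]
      simp only at h1
      linarith
  -- Index `M` occurs only when `L = M + 1`. The tail bounds do not reach it, and its probability is
  -- bounded by `1`.
  have hlayer : ∀ i : Fin L, 𝔼 a, (if lam i < otherLoad Finset.univ (layerHash a i) (X a i) k
      then (1 : ℝ) else 0) ≤ 4 * Del + (1 / 2) ^ (i.val + 1) + if i.val = M then 1 else 0 := by
    intro i
    by_cases hi : i.val = M
    · rw [if_pos hi]
      have : 𝔼 a, (if lam i < otherLoad Finset.univ (layerHash a i) (X a i) k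
          then (1 : ℝ) else 0) ≤ 1 := by
        refine Finset.expect_le Finset.univ_nonempty fun a _ => ?_
        split_ifs <;> norm_num
      have : (0 : ℝ) ≤ (1 / 2) ^ (i.val + 1) := by positivity
      linarith
    · rw [if_neg hi, add_zero]
      have hi' : i.val + 1 ≤ M := by have := i.2; omega
      refine (hX.expect_lt_otherLoad_le hw i (hlam i) (hx0 i) (hV i) k).trans
        (add_le_add ((hexcess i i.2.le hi').trans ?_) (hx1 i))
      have : ((1 : ℝ) / 2) ^ (M - 1 - i.val) ≤ 1 := pow_le_one₀ (by norm_num) (by norm_num)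
      nlinarith
  have hgeom : ∀ n : ℕ, ∑ i ∈ Finset.range n, ((1 : ℝ) / 2) ^ (i + 1) ≤ 1 := by
    intro n
    have : ∑ i ∈ Finset.range n, ((1 : ℝ) / 2) ^ (i + 1) = 1 - (1 / 2) ^ n := by
      induction n with
      | zero => simp
      | succ n ih => rw [Finset.sum_range_succ, ih]; ring
    rw [this]
    have : (0 : ℝ) ≤ (1 / 2) ^ n := by positivity
    linarith
  have hlast : ∑ i ∈ Finset.range L, (if i = M then (1 : ℝ) else 0) ≤ 1 := by
    rw [Finset.sum_ite_eq']
    split_ifs <;> norm_num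
  have hL : (L : ℝ) ≤ M + 1 := by exact_mod_cast hLM
  calc
    𝔼 a, overloads lam X k a = ∑ i : Fin L, 𝔼 a, (if lam i
        < otherLoad Finset.univ (layerHash a i) (X a i) k then (1 : ℝ) else 0) := by
      unfold overloads
      rw [Finset.expect_sum_comm]
    _ ≤ ∑ i : Fin L, (4 * Del + (1 / 2) ^ (i.val + 1) + if i.val = M then 1 else 0) :=
      Finset.sum_le_sum fun i _ => hlayer i
    _ = L * (4 * Del) + ∑ i ∈ Finset.range L, (1 / 2) ^ (i + 1)
        + ∑ i ∈ Finset.range L, (if i = M then 1 else 0) := by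
      rw [Fin.sum_univ_eq_sum_range
        (fun i : ℕ => 4 * Del + (1 / 2) ^ (i + 1) + if i = M then (1 : ℝ) else 0),
        Finset.sum_add_distrib, Finset.sum_add_distrib]
      simp
    _ ≤ 3 + 4 * Del * M := by
      have := hgeom L
      nlinarith

/-! ### The parameters -/

theorem IsDepthRoot.ratio_eq {Rw Rl N Lam Del d : ℝ} (hRw : 1 < Rw) (hRl : 1 < Rl) (hLam : 0 < Lam)
    (hN : 0 < N) (hd : IsDepthRoot Rw Rl N Lam Del d) :
    N / Lam = 2 * (Rw * Rl) ^ 2 * (Rl - 1) * Real.log (1 / Del) * (Rw * Rl) ^ ((2 : ℝ) ^ d)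
      * Rw ^ d := by
  have hw0 : 0 < Rw := by linarith
  have hl0 : 0 < Rl := by linarith
  have hR0 : 0 < Rw * Rl := mul_pos hw0 hl0
  unfold IsDepthRoot delta₁ at hd
  rw [Real.rpow_add hR0, Real.mul_rpow hw0.le hl0.le (z := d)] at hd
  have h1 : 0 < Rl ^ d := Real.rpow_pos_of_pos hl0 d
  have h2 : 0 < Rw ^ d := Real.rpow_pos_of_pos hw0 d
  have h3 : 0 < (Rw * Rl) ^ ((2 : ℝ) ^ d) := Real.rpow_pos_of_pos hR0 _
  generalize Rl ^ d = A at *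
  generalize Rw ^ d = B at *
  generalize (Rw * Rl) ^ ((2 : ℝ) ^ d) = E at *
  generalize Real.log (1 / Del) = l at *
  field_simp at hd ⊢
  linarith

theorem one_le_log_one_div {Del : ℝ} (h0 : 0 < Del) (h1 : Del < 1 / 4) :
    1 ≤ Real.log (1 / Del) := by
  rw [Real.le_log_iff_exp_le (by positivity), le_div_iff₀ h0]
  have := Real.exp_one_lt_d9
  nlinarith

/-- Since `ln (1/Δ) ≥ 1` and `Rw ^ d ≥ 1`, the equation gives `c * (Rw * Rl) ^ (2 ^ d) ≤ N / Λ`. Two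
logarithms isolate `d`; the factor `2` comes from `1 / ln 2 < 2`. -/
theorem exists_depth_bound (Rw Rl : ℝ) (hRw : 1 < Rw) (hRl : 1 < Rl) (hR : 2 ≤ Rw * Rl) :
    ∃ D : ℝ, 0 ≤ D ∧ ∀ N Lam Del d : ℝ, 0 < Lam → Real.exp 1 ≤ N / Lam → 0 < Del → Del < 1 / 4 →
      IsDepthRoot Rw Rl N Lam Del d → 0 ≤ d → d ≤ D + 2 * Real.log (Real.log (N / Lam)) := by
  set c := 2 * (Rw * Rl) ^ 2 * (Rl - 1) with hc
  have hc0 : 0 < c := by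
    have : 0 < Rl - 1 := by linarith
    have : 0 < Rw * Rl := by linarith
    positivity
  -- Chosen so that `2 ^ d ≤ B * ln (N/Λ)`, using `ln (Rw * Rl) ≥ 1/2` and `ln (N/Λ) ≥ 1`.
  set B := 2 * (1 + |Real.log c|) with hB
  have hB1 : 1 ≤ B := by linarith [abs_nonneg (Real.log c)]
  refine ⟨2 * Real.log B, mul_nonneg zero_le_two (Real.log_nonneg hB1), ?_⟩
  intro N Lam Del d hLam hN hDel0 hDel1 hd hd0
  have hQ0 : 0 < N / Lam := (Real.exp_pos 1).trans_le hN
  have hN0 : 0 < N := by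
    rcases div_pos_iff.mp hQ0 with h | h
    · exact h.1
    · linarith [h.2]
  have hQ1 : 1 ≤ Real.log (N / Lam) := (Real.le_log_iff_exp_le hQ0).mpr hN
  have hratio := hd.ratio_eq hRw hRl hLam hN0
  rw [← hc] at hratio
  have hl := one_le_log_one_div hDel0 hDel1
  have hRpos : 0 < (Rw * Rl) ^ ((2 : ℝ) ^ d) := Real.rpow_pos_of_pos (by linarith) _
  have hB' : 1 ≤ Rw ^ d := Real.one_le_rpow hRw.le hd0
  have hle : c * (Rw * Rl) ^ ((2 : ℝ) ^ d) ≤ N / Lam := by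
    rw [hratio]
    have h1 : c * (Rw * Rl) ^ ((2 : ℝ) ^ d) * 1
        ≤ c * (Rw * Rl) ^ ((2 : ℝ) ^ d) * (Real.log (1 / Del) * Rw ^ d) :=
      mul_le_mul_of_nonneg_left (by nlinarith) (by positivity)
    linarith
  have hlog := Real.log_le_log (by positivity) hle
  rw [Real.log_mul hc0.ne' hRpos.ne', Real.log_rpow (by linarith)] at hlog
  have hlogR : 1 / 2 ≤ Real.log (Rw * Rl) := by
    have h1 := Real.log_le_log (by norm_num) hR
    have h2 := Real.log_two_gt_d9
    linarith
  have h2d : 0 < (2 : ℝ) ^ d := Real.rpow_pos_of_pos (by norm_num) _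
  have h2le : (2 : ℝ) ^ d ≤ B * Real.log (N / Lam) := by
    have h1 := neg_abs_le (Real.log c)
    have h2 := abs_nonneg (Real.log c)
    have h3 : (2 : ℝ) ^ d * (1 / 2) ≤ (2 : ℝ) ^ d * Real.log (Rw * Rl) :=
      mul_le_mul_of_nonneg_left hlogR h2d.le
    have h4 : |Real.log c| ≤ |Real.log c| * Real.log (N / Lam) := le_mul_of_one_le_right h2 hQ1
    rw [hB]
    linarith
  have hlog2 := Real.log_le_log h2d h2le
  rw [Real.log_rpow (by norm_num), Real.log_mul (by linarith) (by linarith)] at hlog2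
  have h2 := Real.log_two_gt_d9
  nlinarith

/-! ### Load budgets of the layers and their failure probabilities -/

/-- Bound for the total capped value at a layer, relative to its number of buckets and its
threshold. -/
noncomputable def loadBound (R : ℝ) (n : ℕ) : ℝ := (R ^ 2 ^ (n + 1))⁻¹ / (16 * R)

/-- The number of buckets of a layer before rounding. -/
noncomputable def realWidth (Rw Rl N Lam : ℝ) (n : ℕ) : ℝ :=
  totalWidth Rw Rl N Lam * (Rw - 1) / Rw ^ (n + 1)

theorem totalWidth_pos {Rw Rl N Lam : ℝ} (hRw : 1 < Rw) (hRl : 1 < Rl) (hLam : 0 < Lam)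
    (hN : 0 < N) : 0 < totalWidth Rw Rl N Lam := by
  have h1 : 0 < Rw - 1 := by linarith
  have h2 : 0 < Rl - 1 := by linarith
  have h3 : 0 < Rw := by linarith
  have h4 : 0 < Rl := by linarith
  unfold totalWidth
  positivity

theorem realWidth_pos {Rw Rl N Lam : ℝ} (hRw : 1 < Rw) (hRl : 1 < Rl) (hLam : 0 < Lam)
    (hN : 0 < N) (n : ℕ) : 0 < realWidth Rw Rl N Lam n := by
  have h0 := totalWidth_pos hRw hRl hLam hN
  have h1 : 0 < Rw - 1 := by linarith
  have h3 : 0 < Rw := by linarith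
  unfold realWidth
  positivity

theorem loadBound_le {R : ℝ} (hR : 2 ≤ R) (n : ℕ) : loadBound R n ≤ (1 / 2) ^ (n + 1) := by
  have h0 : (2 : ℝ) ^ (n + 1) ≤ R ^ 2 ^ (n + 1) :=
    (pow_le_pow_left₀ (by norm_num) hR _).trans
      (pow_le_pow_right₀ (by linarith) Nat.lt_two_pow_self.le)
  have h1 : (R ^ 2 ^ (n + 1))⁻¹ ≤ ((2 : ℝ) ^ (n + 1))⁻¹ := inv_anti₀ (by positivity) h0
  unfold loadBound
  rw [one_div, inv_pow]
  refine (div_le_self (by positivity) (by linarith)).trans h1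

/-- Threshold times unrounded width shrinks by the factor `R = Rw * Rl` per layer. Hence this
recursion is exactly what carries the budget `λ_n V_n` to `λ_{n+1} V_{n+1}` with the loss factor `16
x_n`. -/
theorem loadBound_succ {R : ℝ} (hR : 0 < R) (n : ℕ) :
    16 * R * loadBound R n ^ 2 = loadBound R (n + 1) := by
  unfold loadBound
  rw [pow_succ 2 (n + 1), pow_mul R]
  field_simp

theorem mul_loadBound_mul_realWidth {Rw Rl N Lam : ℝ} (hRw : 1 < Rw) (hRl : 1 < Rl)
    (hLam : 0 < Lam) (n : ℕ) :
    4 * loadBound (Rw * Rl) n * (loadBound (Rw * Rl) n * realWidth Rw Rl N Lam n)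
      = N / Lam * (Rw * Rl) ^ 4 / (16 * (Rl - 1) * Rw ^ (n + 1) * (Rw * Rl) ^ 2 ^ (n + 2)) := by
  have h1 : Rw - 1 ≠ 0 := by linarith
  have h2 : Rl - 1 ≠ 0 := by linarith
  have h3 : Rw ≠ 0 := by linarith
  have h4 : Rl ≠ 0 := by linarith
  have h5 : Rw * Rl ≠ 0 := mul_ne_zero h3 h4
  have h6 : (Rw * Rl) ^ 2 ^ (n + 2) = ((Rw * Rl) ^ 2 ^ (n + 1)) ^ 2 := by
    rw [← pow_mul, ← pow_succ]
  rw [h6]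
  unfold loadBound realWidth totalWidth
  have h7 : (Rw * Rl) ^ 2 ^ (n + 1) ≠ 0 := pow_ne_zero _ h5
  generalize (Rw * Rl) ^ 2 ^ (n + 1) = E at *
  have h8 : Rw ^ (n + 1) ≠ 0 := pow_ne_zero _ h3
  generalize Rw ^ (n + 1) = B at *
  generalize Rw * Rl = R at *
  field_simp
  ring

/-- With `j = M - 2 - n`, substituting the equation for `d` makes the exponent at least `(1 + j) ln
(1/Δ)`, so the failure probability is at most `Δ ^ (1 + j)`. -/
theorem IsDepthRoot.exp_neg_le {Rw Rl N Lam Del d : ℝ} (hRw : 1 < Rw) (hRl : 1 < Rl)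
    (hR : 2 ≤ Rw * Rl) (hLam : 0 < Lam) (hN : 0 < N) (hDel0 : 0 < Del) (hDel1 : Del < 1 / 4)
    (hd : IsDepthRoot Rw Rl N Lam Del d) {M : ℕ} (hM : M ≤ d) {n : ℕ} (hn : n + 2 ≤ M) :
    Real.exp (-(4 * loadBound (Rw * Rl) n * (loadBound (Rw * Rl) n * realWidth Rw Rl N Lam n)))
      ≤ Del * (1 / 2) ^ (M - 2 - n) := by
  obtain ⟨j, rfl⟩ := Nat.exists_eq_add_of_le hn
  have hj : n + 2 + j - 2 - n = j := by omega
  rw [hj, mul_loadBound_mul_realWidth hRw hRl hLam, hd.ratio_eq hRw hRl hLam hN]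
  set R := Rw * Rl
  have hl := one_le_log_one_div hDel0 hDel1
  set l := Real.log (1 / Del) with hldef
  -- From `2 ^ d ≥ 2 ^ (n + 2 + j) ≥ 2 ^ (n + 2) + j` and `R ^ j ≥ 2 ^ j ≥ 1 + j`.
  have hRpow : R ^ 2 ^ (n + 2) * (1 + j) ≤ R ^ ((2 : ℝ) ^ d) := by
    have h1 : R ^ ((2 ^ (n + 2 + j) : ℕ) : ℝ) ≤ R ^ ((2 : ℝ) ^ d) := by
      refine Real.rpow_le_rpow_of_exponent_le (by linarith) ?_
      push_cast
      rw [← Real.rpow_natCast]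
      exact Real.rpow_le_rpow_of_exponent_le (by norm_num) hM
    rw [Real.rpow_natCast] at h1
    refine le_trans ?_ h1
    have h2 : 2 ^ (n + 2) + j ≤ 2 ^ (n + 2 + j) := by
      have h3 : j + 1 ≤ 2 ^ j := Nat.lt_two_pow_self
      have h4 : 1 ≤ 2 ^ (n + 2) := Nat.one_le_two_pow
      rw [pow_add 2 (n + 2) j]
      nlinarith
    refine le_trans ?_ (pow_le_pow_right₀ (by linarith) h2)
    rw [pow_add R (2 ^ (n + 2)) j]
    refine mul_le_mul_of_nonneg_left ?_ (by positivity)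
    have h3 : ((j + 1 : ℕ) : ℝ) ≤ ((2 ^ j : ℕ) : ℝ) := Nat.cast_le.mpr Nat.lt_two_pow_self
    push_cast at h3
    have h4 : (2 : ℝ) ^ j ≤ R ^ j := pow_le_pow_left₀ (by norm_num) hR j
    linarith
  have hRwpow : Rw ^ (n + 1) ≤ Rw ^ d := by
    rw [← Real.rpow_natCast]
    refine Real.rpow_le_rpow_of_exponent_le hRw.le (le_trans ?_ hM)
    exact_mod_cast (by omega : n + 1 ≤ n + 2 + j)
  have hexponent : l * (1 + j) ≤ 2 * R ^ 2 * (Rl - 1) * l * R ^ ((2 : ℝ) ^ d) * Rw ^ d * R ^ 4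
      / (16 * (Rl - 1) * Rw ^ (n + 1) * R ^ 2 ^ (n + 2)) := by
    have h1 : 0 < Rl - 1 := by linarith
    have h2 : 0 < Rw := by linarith
    have h3 : 0 < R := by linarith
    rw [le_div_iff₀ (by positivity)]
    have h4 : 8 ≤ R ^ 6 := by
      have : (2 : ℝ) ^ 6 ≤ R ^ 6 := pow_le_pow_left₀ (by norm_num) hR 6
      linarith
    have h5 : Rw ^ (n + 1) * (R ^ 2 ^ (n + 2) * (1 + j)) ≤ Rw ^ d * R ^ ((2 : ℝ) ^ d) :=
      mul_le_mul hRwpow hRpow (by positivity) (by positivity)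
    calc
      l * (1 + j) * (16 * (Rl - 1) * Rw ^ (n + 1) * R ^ 2 ^ (n + 2))
        = 2 * (Rl - 1) * l * 8 * (Rw ^ (n + 1) * (R ^ 2 ^ (n + 2) * (1 + j))) := by ring
      _ ≤ 2 * (Rl - 1) * l * R ^ 6 * (Rw ^ d * R ^ ((2 : ℝ) ^ d)) := by gcongr
      _ = _ := by ring
  have hexp : Real.exp (-(l * (1 + j))) = Del * Del ^ j := by
    have h1 : -(l * (1 + j)) = ((1 + j : ℕ) : ℝ) * Real.log Del := by
      rw [hldef, one_div, Real.log_inv]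
      push_cast
      ring
    rw [h1, Real.exp_nat_mul, Real.exp_log hDel0, pow_add, pow_one]
  calc
    _ ≤ Real.exp (-(l * (1 + j))) := Real.exp_le_exp.mpr (neg_le_neg hexponent)
    _ = Del * Del ^ j := hexp
    _ ≤ Del * (1 / 2) ^ j := by
      have : Del ≤ 1 / 2 := by linarith
      gcongr

/-! ### Space -/

theorem space_le {Rw Rl N Lam Del : ℝ} (hRw : 1 < Rw) (hRl : 1 < Rl) (hLam : 0 < Lam)
    (hN : 0 < N) (hDel0 : 0 < Del) (hDel1 : Del < 1 / 4) (L : ℕ) :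
    (space (width Rw Rl N Lam L) (tailSize Rw Rl Del) : ℝ)
      ≤ 3 * totalWidth Rw Rl N Lam + 3 * L + 3 * (delta₂ Rw Rl * Real.log (1 / Del) + 1) := by
  have hW := totalWidth_pos hRw hRl hLam hN
  have hl := one_le_log_one_div hDel0 hDel1
  have hRw0 : 0 < Rw := by linarith
  have hRl0 : 0 < Rl := by linarith
  have hwidth : ∀ i : Fin L, (width Rw Rl N Lam L i : ℝ) ≤ realWidth Rw Rl N Lam i + 1 := fun i =>
    (Nat.ceil_lt_add_one (realWidth_pos hRw hRl hLam hN i).le).le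
  have htail : (tailSize Rw Rl Del : ℝ) ≤ delta₂ Rw Rl * Real.log (1 / Del) + 1 :=
    (Nat.ceil_lt_add_one (by unfold delta₂; positivity)).le
  have hgeom : ∀ n : ℕ, ∑ i ∈ Finset.range n, realWidth Rw Rl N Lam i
      = totalWidth Rw Rl N Lam * (1 - (Rw ^ n)⁻¹) := by
    intro n
    induction n with
    | zero => simp
    | succ n ih =>
      rw [Finset.sum_range_succ, ih]
      unfold realWidth
      field_simp
      ring
  have hsum : ∑ i : Fin L, (width Rw Rl N Lam L i : ℝ) ≤ totalWidth Rw Rl N Lam + L := by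
    refine (Finset.sum_le_sum fun i _ => hwidth i).trans ?_
    rw [Finset.sum_add_distrib, Fin.sum_univ_eq_sum_range (realWidth Rw Rl N Lam), hgeom]
    have : (0 : ℝ) < (Rw ^ L)⁻¹ := by positivity
    simp only [Finset.sum_const, Finset.card_univ, Fintype.card_fin, nsmul_eq_mul, mul_one]
    nlinarith
  unfold space
  push_cast
  rw [← Finset.mul_sum]
  linarith

/-! ### Time -/

theorem expect_overloads_le {K : Type*} [DecidableEq K] {Rw Rl N Lam Del d : ℝ} {L : ℕ}
    (hRw : 1 < Rw) (hRl : 1 < Rl) (hR : 2 ≤ Rw * Rl) (hLam : 0 < Lam) (hN : 0 < N)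
    (hDel0 : 0 < Del) (hDel1 : Del < 1 / 4) (hd : IsDepthRoot Rw Rl N Lam Del d) {M : ℕ}
    (hM : M ≤ d) (hLM : L ≤ M + 1) (m : ℕ) (hw : ∀ i, 0 < width Rw Rl N Lam L i) {Ks : Finset K}
    {S : List (K × ℝ)} (hS : ∀ x ∈ S, x.1 ∈ Ks ∧ 0 < x.2) (hsum : (S.map Prod.snd).sum = N)
    (k : Ks) :
    𝔼 a, overloads (fun n => Lam * (Rl - 1) / Rl ^ (n + 1))
      (keyArrivals m (fun n => Lam * (Rl - 1) / Rl ^ (n + 1)) hw Ks S) k a ≤ 3 + 4 * Del * M := by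
  have hl1 : 0 < Rl - 1 := by linarith
  have hl0 : 0 < Rl := by linarith
  have hw1 : 0 < Rw - 1 := by linarith
  have hw0 : 0 < Rw := by linarith
  have hR0 : 0 < Rw * Rl := by linarith
  have hlam : ∀ n : ℕ, 0 < Lam * (Rl - 1) / Rl ^ (n + 1) := fun n => by positivity
  have hx0 : ∀ n, 0 ≤ loadBound (Rw * Rl) n := fun n => by
    unfold loadBound
    positivity
  refine (layeredArrivals_keyArrivals m (fun n => (hlam n).le) hw hS).expect_overloads_le hw hlam
    (fun n => ?_) (x := loadBound (Rw * Rl))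
    (V := fun n => loadBound (Rw * Rl) n * realWidth Rw Rl N Lam n) hx0
    (loadBound_le hR) (fun i => mul_le_mul_of_nonneg_left (Nat.le_ceil _) (hx0 i))
    (fun n => le_of_eq ?_) (fun a => ?_) hDel0 hDel1 hLM
    (fun n hn => hd.exp_neg_le hRw hRl hR hLam hN hDel0 hDel1 hM hn) k
  · rw [pow_succ Rl (n + 1)]
    refine div_le_div_of_nonneg_left (by positivity) (by positivity) ?_
    exact le_mul_of_one_le_right (by positivity) hRl.le
  · rw [← loadBound_succ hR0]
    unfold realWidth
    field_simp
    ring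
  · rw [sum_keyArrivals_zero m _ hw (fun x hx => (hS x hx).1), hsum]
    unfold realWidth totalWidth loadBound
    have h3 : (4 : ℝ) ≤ (Rw * Rl) ^ 2 := by nlinarith
    -- The factor `4 (Rw * Rl) ^ 6` in `W` makes the first budget `N (Rw * Rl) ^ 2 / 4`, which is at
    -- least the stream total `N`.
    have h4 : Lam * (Rl - 1) / Rl ^ (0 + 1) * (((Rw * Rl) ^ 2 ^ (0 + 1))⁻¹ / (16 * (Rw * Rl)) *
        (4 * N * (Rw * Rl) ^ 6 / (Lam * (Rw - 1) * (Rl - 1)) * (Rw - 1) / Rw ^ (0 + 1)))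
        = N * ((Rw * Rl) ^ 2 / 4) := by
      field_simp
      ring
    rw [h4]
    nlinarith

/-- With `M = ⌊d⌋` the bound is `4 + 4Δ(D + 2 ln ln (N/Λ))`, and `4Δ < 1` absorbs `D`. -/
theorem expect_one_add_overloads_le {K : Type*} [DecidableEq K] {Rw Rl N Lam Del d D : ℝ} {L : ℕ}
    (hRw : 1 < Rw) (hRl : 1 < Rl) (hR : 2 ≤ Rw * Rl) (hLam : 0 < Lam) (hN : 0 < N)
    (hDel0 : 0 < Del) (hDel1 : Del < 1 / 4) (hd : IsDepthRoot Rw Rl N Lam Del d)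
    (hL : L = ⌊d⌋₊ ∨ L = ⌈d⌉₊) (hD : 0 ≤ D) (hlog : 0 ≤ Real.log (Real.log (N / Lam)))
    (hbound : 0 ≤ d → d ≤ D + 2 * Real.log (Real.log (N / Lam)))
    (m : ℕ) (hw : ∀ i, 0 < width Rw Rl N Lam L i) {Ks : Finset K}
    {S : List (K × ℝ)} (hS : ∀ x ∈ S, x.1 ∈ Ks ∧ 0 < x.2) (hsum : (S.map Prod.snd).sum = N)
    (k : Ks) :
    1 + 𝔼 a, overloads (fun n => Lam * (Rl - 1) / Rl ^ (n + 1))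
      (keyArrivals m (fun n => Lam * (Rl - 1) / Rl ^ (n + 1)) hw Ks S) k a
      ≤ (8 + D) * (1 + Del * Real.log (Real.log (N / Lam))) := by
  have hDl : 0 ≤ Del * Real.log (Real.log (N / Lam)) := mul_nonneg hDel0.le hlog
  have hDDl : 0 ≤ D * (Del * Real.log (Real.log (N / Lam))) := mul_nonneg hD hDl
  rcases le_or_gt 0 d with hd0 | hd0
  · have hM := Nat.floor_le hd0
    have hLM : L ≤ ⌊d⌋₊ + 1 := by
      rcases hL with rfl | rfl
      · exact Nat.le_succ _
      · exact Nat.ceil_le_floor_add_one d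
    have h1 := expect_overloads_le hRw hRl hR hLam hN hDel0 hDel1 hd hM hLM m hw hS hsum k
    have h2 : Del * (⌊d⌋₊ : ℝ) ≤ Del * (D + 2 * Real.log (Real.log (N / Lam))) :=
      mul_le_mul_of_nonneg_left (hM.trans (hbound hd0)) hDel0.le
    have h3 : Del * D ≤ 1 / 4 * D := mul_le_mul_of_nonneg_right hDel1.le hD
    linarith
  -- A negative root leaves no layers: each item costs the single SpaceSaving step.
  · obtain rfl : L = 0 := by
      rcases hL with rfl | rfl
      · exact Nat.floor_of_nonpos hd0.le
      · exact Nat.ceil_eq_zero.mpr hd0.le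
    simp only [overloads, Finset.univ_eq_empty, Finset.sum_empty, Finset.expect_const_zero]
    linarith

end ReliableSketch

/-! ### Assembly of the space and time bounds -/

open scoped BigOperators in
theorem mainTheorem2 (Rw Rl : ℝ) (hRw : 1 < Rw) (hRl : 1 < Rl) (hR : 2 ≤ Rw * Rl) :
    ∃ C : ℝ, 0 < C ∧
      ∀ (N Lam Del d : ℝ) (L : ℕ), 0 < Lam → Real.exp 1 ≤ N / Lam → 0 < Del → Del < 1 / 4 →
        ReliableSketch.IsDepthRoot Rw Rl N Lam Del d → (L = ⌊d⌋₊ ∨ L = ⌈d⌉₊) →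
        -- space
        (ReliableSketch.space (ReliableSketch.width Rw Rl N Lam L)
            (ReliableSketch.tailSize Rw Rl Del) : ℝ) ≤ C * (N / Lam + Real.log (1 / Del)) ∧
        -- time
        ∀ (K Ω : Type*) [DecidableEq K] [MeasurableSpace Ω] (P : MeasureTheory.Measure Ω)
          [MeasureTheory.IsProbabilityMeasure P]
          (H : (i : Fin L) → K → Ω → Fin (ReliableSketch.width Rw Rl N Lam L i)),
          ReliableSketch.IsUniformHash P H →
          ∀ S : List (K × ℝ), (∀ x ∈ S, 0 < x.2) → (S.map Prod.snd).sum = N →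
            (∀ t : Fin S.length,
              ∫⁻ ω, (ReliableSketch.insertTime (ReliableSketch.tailSize Rw Rl Del)
                  (ReliableSketch.threshold Rl Lam L) (fun i e => H i e ω) S t : ENNReal) ∂P
                ≤ ENNReal.ofReal (C * (1 + Del * Real.log (Real.log (N / Lam))))) ∧
            ∫⁻ ω, (ReliableSketch.totalTime (ReliableSketch.tailSize Rw Rl Del)
                (ReliableSketch.threshold Rl Lam L) (fun i e => H i e ω) S : ENNReal) ∂P
              ≤ ENNReal.ofReal (C * (1 + Del * Real.log (Real.log (N / Lam))) * S.length) := by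
  
  obtain ⟨D, hD, hdepth⟩ := ReliableSketch.exists_depth_bound Rw Rl hRw hRl hR
  have hw1 : 0 < Rw - 1 := by linarith
  have hl1 : 0 < Rl - 1 := by linarith
  have hw0 : 0 < Rw := by linarith
  have hl0 : 0 < Rl := by linarith
  set cW := 4 * (Rw * Rl) ^ 6 / ((Rw - 1) * (Rl - 1)) with hcW
  have hcW0 : 0 < cW := by positivity
  set c₂ := ReliableSketch.delta₂ Rw Rl with hc₂
  have hc₂0 : 0 < c₂ := by
    rw [hc₂]
    unfold ReliableSketch.delta₂
    positivity
  -- The last bracket is for time, the rest for space: `3L ≤ 3(D + 3) N/Λ` for rounding the widths,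
  -- and `3` more for rounding the number of counters.
  set C := 3 * cW + 3 * c₂ + 3 * D + 12 + (8 + D) with hC
  have hCtime : 8 + D ≤ C := by linarith
  refine ⟨C, by positivity, ?_⟩
  intro N Lam Del d L hLam hNLam hDel0 hDel1 hd hL
  have hQ0 : 0 < N / Lam := (Real.exp_pos 1).trans_le hNLam
  have hN : 0 < N := by
    have := mul_pos hQ0 hLam
    rwa [div_mul_cancel₀ _ hLam.ne'] at this
  have hQ1 : 1 ≤ N / Lam := by linarith [Real.add_one_le_exp 1]
  have hlogQ : 1 ≤ Real.log (N / Lam) := (Real.le_log_iff_exp_le hQ0).mpr hNLam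
  have hloglog : 0 ≤ Real.log (Real.log (N / Lam)) := Real.log_nonneg hlogQ
  have hl := ReliableSketch.one_le_log_one_div hDel0 hDel1
  have hbound := hdepth N Lam Del d hLam hNLam hDel0 hDel1 hd
  constructor
  · refine (ReliableSketch.space_le hRw hRl hLam hN hDel0 hDel1 L).trans ?_
    have hW : ReliableSketch.totalWidth Rw Rl N Lam = cW * (N / Lam) := by
      rw [hcW]
      unfold ReliableSketch.totalWidth
      field_simp
    have hLle : (L : ℝ) ≤ (D + 3) * (N / Lam) := by
      rcases le_or_gt 0 d with hd0 | hd0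
      · have h1 : (L : ℝ) ≤ d + 1 := by
          rcases hL with rfl | rfl
          · linarith [Nat.floor_le hd0]
          · exact (Nat.ceil_lt_add_one hd0).le
        have h2 : Real.log (Real.log (N / Lam)) ≤ N / Lam :=
          (Real.log_le_self (by linarith)).trans (Real.log_le_self hQ0.le)
        have h3 : D ≤ D * (N / Lam) := le_mul_of_one_le_right hD hQ1
        linarith [hbound hd0]
      · have : L = 0 := by
          rcases hL with rfl | rfl
          · exact Nat.floor_of_nonpos hd0.le
          · exact Nat.ceil_eq_zero.mpr hd0.le
        rw [this, Nat.cast_zero]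
        positivity
    rw [hW, ← hc₂, hC]
    have h1 : 0 ≤ c₂ * (N / Lam) := by positivity
    have h2 : 0 ≤ D * (N / Lam) := by positivity
    have h3 : 0 ≤ (3 * cW + 3 * D + 12 + (8 + D)) * Real.log (1 / Del) := by positivity
    linarith
  · intro K Ω _ _ P _ H hH S hS hsum
    have hw : ∀ i, 0 < ReliableSketch.width Rw Rl N Lam L i := fun i =>
      Nat.ceil_pos.mpr (ReliableSketch.realWidth_pos hRw hRl hLam hN i)
    let Ks : Finset K := (S.map Prod.fst).toFinset
    have hKs : ∀ x ∈ S, x.1 ∈ Ks ∧ 0 < x.2 := fun x hx =>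
      ⟨List.mem_toFinset.mpr (List.mem_map_of_mem hx), hS x hx⟩
    let m := ReliableSketch.tailSize Rw Rl Del
    let lam : ℕ → ℝ := fun n => Lam * (Rl - 1) / Rl ^ (n + 1)
    have hlam : ∀ n, 0 ≤ lam n := fun n => by positivity
    let F (t : Fin S.length)
        (a : (p : Fin L × Ks) → Fin (ReliableSketch.width Rw Rl N Lam L p.1)) : ℝ :=
      1 + ReliableSketch.overloads lam (ReliableSketch.keyArrivals m lam hw Ks S)
        ⟨(S.get t).1, (hKs _ (List.get_mem S t)).1⟩ a
    have hF0 : ∀ t a, 0 ≤ F t a := fun t a =>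
      add_nonneg zero_le_one (Finset.sum_nonneg fun i _ => by split_ifs <;> norm_num)
    have htime : ∀ t ω, (ReliableSketch.insertTime m (ReliableSketch.threshold Rl Lam L)
        (fun i e => H i e ω) S t : ℝ) ≤ F t fun p => H p.1 p.2 ω := fun t ω =>
      ReliableSketch.insertTime_le_overloads m hlam hw hKs (fun i e => H i e ω) t
    have hne : ∀ p : Fin L × Ks, Nonempty (Fin (ReliableSketch.width Rw Rl N Lam L p.1)) :=
      fun p => ⟨⟨0, hw p.1⟩⟩
    have hexpect : ∀ t, 𝔼 a, F t a ≤ C * (1 + Del * Real.log (Real.log (N / Lam))) := fun t => by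
      have h1 := ReliableSketch.expect_one_add_overloads_le hRw hRl hR hLam hN hDel0 hDel1 hd hL
        hD hloglog hbound m hw hKs hsum ⟨(S.get t).1, (hKs _ (List.get_mem S t)).1⟩
      have h2 : (8 + D) * (1 + Del * Real.log (Real.log (N / Lam)))
          ≤ C * (1 + Del * Real.log (Real.log (N / Lam))) :=
        mul_le_mul_of_nonneg_right hCtime (by positivity)
      rw [Finset.expect_add_distrib, Fintype.expect_const]
      exact h1.trans h2
    constructor
    · intro t
      calc
        _ ≤ ∫⁻ ω, ENNReal.ofReal (F t fun p => H p.1 p.2 ω) ∂P := by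
          refine MeasureTheory.lintegral_mono fun ω => ?_
          rw [← ENNReal.ofReal_natCast]
          exact ENNReal.ofReal_le_ofReal (htime t ω)
        _ = ENNReal.ofReal (𝔼 a, F t a) := hH.lintegral_restrict hw Ks (hF0 t)
        _ ≤ _ := ENNReal.ofReal_le_ofReal (hexpect t)
    · calc
        _ ≤ ∫⁻ ω, ENNReal.ofReal ((fun a => ∑ t, F t a) fun p => H p.1 p.2 ω) ∂P := by
          refine MeasureTheory.lintegral_mono fun ω => ?_
          rw [← ENNReal.ofReal_natCast]
          refine ENNReal.ofReal_le_ofReal ?_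
          unfold ReliableSketch.totalTime
          push_cast
          exact Finset.sum_le_sum fun t _ => htime t ω
        _ = ENNReal.ofReal (𝔼 a, ∑ t, F t a) :=
          hH.lintegral_restrict hw Ks fun a => Finset.sum_nonneg fun t _ => hF0 t a
        _ ≤ _ := by
          refine ENNReal.ofReal_le_ofReal ?_
          rw [Finset.expect_sum_comm]
          refine (Finset.sum_le_sum fun t _ => hexpect t).trans_eq ?_
          simp [mul_comm]
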